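/- Let $T$ be the rooted binary tree, with vertex set $v(T)$ (the finite words in two letters) and root $r$; every vertex $v\neq r$ has a parent $\mathrm{par}(v)$, and every vertex has exactly two children. Let $H=\ell^2(T):=\ell^2(v(T))$ and let $S$ be the bounded shift operator on $H$, $(Sf)(v)=f(\mathrm{par}(v))$ for $v\neq r$ and $(Sf)(r)=0$. Let $K=\{0,1\}^{\mathbb N}$ be the Cantor set of infinite paths starting at $r$, and let $T_0=v(T)\cup K$ be the compactification of $v(T)$ with boundary $K$, in which every vertex is isolated and the sets of all (finite or infinite) words extending a given initial segment of $x\in K$ form a neighbourhood basis of $x$. Let $C(T_0)$ act on $H$ by pointwise multiplication (by the restriction to $v(T)$), and let $A$ be the $C^*$-algebra on $H$ generated by $S$ and $C(T_0)$. Let $[A,A]$ be the commutator ideal of $A$, that is, the closed two-sided ideal of $A$ generated by the commutators $ab-ba$, $a,b\in A$. Write $\mathcal K(\cdot)$ for the algebra of compact operators, and $\mathbb Z_+=\{0,1,2,\dots\}$. **Theorem 4.1.** The ideal $[A,A]$ contains $\mathcal K(\ell^2(T))$, and there exists a $*$-homomorphism $\pi:[A,A]\to\mathcal K(\ell^2(\mathbb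 Z_+))\otimes C(K)$ such that the sequence $$0\longrightarrow \mathcal K(\ell^2(T))\longrightarrow [A,A]\xrightarrow{\ \pi\ }\mathcal K(\ell^2(\mathbb Z_+))\otimes C(K)\longrightarrow 0,$$ whose first map is the inclusion, is exact. Here $\otimes$ is the $C^*$-tensor product, realised as the closed span of the functions $x\mapsto f(x)k$ ($k\in\mathcal K(\ell^2(\mathbb Z_+))$, $f\in C(K)$) in the continuous operator-valued functions on $K$ with the supremum norm. -/

import Mathlib

open scoped lp

noncomputable section

namespace BinaryTree

/-! ### C*-algebras of operators -/

section General

variable {H : Type*} [NormedAddCommGroup H] [InnerProductSpace ℂ H] [CompleteSpace H]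

/-- Schauder's theorem for operators on a Hilbert space. -/
theorem isCompactOperator_star {T : H →L[ℂ] H} (hT : IsCompactOperator T) :
    IsCompactOperator (star T : H →L[ℂ] H) := by
  rw [← ContinuousLinearMap.coe_coe,
    isCompactOperator_iff_isCompact_closure_image_ball _ one_pos]
  have hR : TotallyBounded ((T * star T : H →L[ℂ] H) '' Metric.ball 0 1) :=
    (((hT.comp_clm (star T)).isCompact_closure_image_ball
      (f := ((T * star T : H →L[ℂ] H) : H →ₗ[ℂ] H)) 1).totallyBounded).subset subset_closure
  refine TotallyBounded.isCompact_of_isClosed (TotallyBounded.closure ?_) isClosed_closure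
  rw [Metric.totallyBounded_iff]
  intro ε hε
  obtain ⟨t, hts, htf, ht⟩ := Metric.finite_approx_of_totallyBounded hR (ε ^ 2 / 2) (by positivity)
  obtain ⟨t', ht's, ht'f, rfl⟩ := (Set.exists_subset_image_finite_and
    (p := fun u => u = t)).1 ⟨t, hts, htf, rfl⟩
  refine ⟨(star T : H →L[ℂ] H) '' t', ht'f.image _, ?_⟩
  rintro _ ⟨x, hx, rfl⟩
  obtain ⟨_, ⟨y, hy, rfl⟩, hxy⟩ := Set.mem_iUnion₂.1 (ht (Set.mem_image_of_mem _ hx))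
  refine Set.mem_iUnion₂.2 ⟨_, Set.mem_image_of_mem _ hy, ?_⟩
  have hyb := ht's hy
  simp only [Metric.mem_ball, dist_eq_norm, sub_zero, ContinuousLinearMap.coe_coe] at *
  rw [← map_sub] at hxy ⊢
  have h1 : ‖(star T) (x - y)‖ ^ 2 ≤ ‖(T * star T) (x - y)‖ * ‖x - y‖ := by
    rw [← inner_self_eq_norm_sq (𝕜 := ℂ)]
    conv_lhs => rw [ContinuousLinearMap.star_eq_adjoint, ContinuousLinearMap.adjoint_inner_right]
    exact (RCLike.re_le_norm _).trans (norm_inner_le_norm _ _)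
  have h2 : ‖x - y‖ < 2 := (norm_sub_le _ _).trans_lt (by linarith)
  have h3 : ‖(T * star T) (x - y)‖ * ‖x - y‖ ≤ ‖(T * star T) (x - y)‖ * 2 := by gcongr
  exact lt_of_pow_lt_pow_left₀ 2 hε.le (by linarith)

variable (H) in
/-- The C*-algebra `𝒦(H)` of compact operators on the Hilbert space `H`. -/
def compacts : NonUnitalStarSubalgebra ℂ (H →L[ℂ] H) where
  carrier := {T | IsCompactOperator T}
  add_mem' := fun hS hT => hS.add hT
  zero_mem' := isCompactOperator_zero
  mul_mem' := fun {_ T} hS _ => hS.comp_clm T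
  smul_mem' := fun c _ hT => hT.smul c
  star_mem' := fun hT => isCompactOperator_star hT

/-- The spatial (minimal) C*-tensor product `M ⊗ C(X)` of a C*-algebra `M` of operators on `H`
with the algebra of continuous functions on a compact space `X`: the norm closure, in the
C*-algebra of continuous operator-valued functions on `X` with the supremum norm, of the algebra
spanned by the elementary tensors `k ⊗ f`, that is, by the functions `x ↦ f x • k`. -/
def tensorContinuous (M : NonUnitalStarSubalgebra ℂ (H →L[ℂ] H))
    (X : Type*) [TopologicalSpace X] [CompactSpace X] :
    NonUnitalStarSubalgebra ℂ C(X, H →L[ℂ] H) :=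
  (NonUnitalStarAlgebra.adjoin ℂ
    {F : C(X, H →L[ℂ] H) | ∃ k ∈ M, ∃ f : C(X, ℂ), ∀ x, F x = f x • k}).topologicalClosure

end General

section CommutatorIdeal

variable {B : Type*} [CStarAlgebra B]

/-- The elements `x (a b - b a) y` with `x, a, b, y` in `A`. -/
def commutatorSet (A : StarSubalgebra ℂ B) : Set B :=
  {T | ∃ x ∈ A, ∃ a ∈ A, ∃ b ∈ A, ∃ y ∈ A, T = x * (a * b - b * a) * y}

/-- The algebraic two-sided ideal of `A` generated by the commutators; as `A` is unital, it is the
linear span of the elements `x (a b - b a) y`. -/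
def algCommutatorIdeal (A : StarSubalgebra ℂ B) : NonUnitalStarSubalgebra ℂ B where
  carrier := (Submodule.span ℂ (commutatorSet A) : Set B)
  add_mem' := fun hS hT => add_mem hS hT
  zero_mem' := zero_mem _
  smul_mem' := fun c _ hT => Submodule.smul_mem _ c hT
  mul_mem' := by
    intro S T hS hT
    have hT' : T ∈ A := by
      refine (Submodule.span_le (p := Subalgebra.toSubmodule A.toSubalgebra)).2 ?_ hT
      rintro _ ⟨x, hx, a, ha, b, hb, y, hy, rfl⟩
      exact show _ ∈ A from mul_mem (mul_mem hx (sub_mem (mul_mem ha hb) (mul_mem hb ha))) hy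
    refine Submodule.span_induction (p := fun S _ => S * T ∈ Submodule.span ℂ (commutatorSet A))
      ?_ ?_ ?_ ?_ hS
    · rintro _ ⟨x, hx, a, ha, b, hb, y, hy, rfl⟩
      exact Submodule.subset_span ⟨x, hx, a, ha, b, hb, y * T, mul_mem hy hT', by
        simp only [mul_assoc]⟩
    · simp
    · intro S S' _ _ h h'
      rw [add_mul]
      exact add_mem h h'
    · intro c S _ h
      rw [smul_mul_assoc]
      exact Submodule.smul_mem _ c h
  star_mem' := by
    intro S hS
    refine Submodule.span_induction (p := fun S _ => star S ∈ Submodule.span ℂ (commutatorSet A))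
      ?_ ?_ ?_ ?_ hS
    · rintro _ ⟨x, hx, a, ha, b, hb, y, hy, rfl⟩
      exact Submodule.subset_span ⟨star y, star_mem hy, star b, star_mem hb, star a, star_mem ha,
        star x, star_mem hx, by simp [mul_assoc]⟩
    · simp
    · intro S S' _ _ h h'
      rw [star_add]
      exact add_mem h h'
    · intro c S _ h
      rw [star_smul]
      exact Submodule.smul_mem _ _ h

/-- The commutator ideal `[A, A]` of a unital C*-algebra `A` (given as a subalgebra of `B`): the
closed two-sided ideal of `A` generated by the commutators `a b - b a`. -/
def commutatorIdeal (A : StarSubalgebra ℂ B) : NonUnitalStarSubalgebra ℂ B :=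
  (algCommutatorIdeal A).topologicalClosure

end CommutatorIdeal

/-! ### The binary tree and its boundary -/

/-- The vertices of the binary tree: finite words in two letters. The root is the empty word, the
children of `u` are `u ++ [false]` and `u ++ [true]`, the parent of `v ≠ []` is `v.dropLast`. -/
abbrev Vertex : Type := List Bool

/-- The space `K` of infinite paths from the root, a Cantor set (with the product topology). -/
abbrev Boundary : Type := ℕ → Bool

instance : TopologicalSpace (Option Bool) := ⊥

instance : DiscreteTopology (Option Bool) := ⟨rfl⟩

/-- The compactification `T₀ = v(T) ∪ K` of the vertex set, as the space of finite or infinite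
words in two letters: a word is a sequence of letters `some c`, continued by `none` after its
end. The topology is that of coordinatewise convergence: every vertex is isolated, and the words
that extend a given finite initial piece of an infinite path form a neighbourhood basis of it. -/
abbrev Compactification : Type :=
  {s : ℕ → Option Bool // ∀ n, s n = none → s (n + 1) = none}

instance : CompactSpace Compactification := by
  have hc : IsClosed {s : ℕ → Option Bool | ∀ n, s n = none → s (n + 1) = none} := by
    rw [Set.ofPred_forall]
    refine isClosed_iInter fun n => ?_
    have h : Continuous fun s : ℕ → Option Bool => (s n, s (n + 1)) := by fun_prop
    exact (isClosed_discrete {q : Option Bool × Option Bool | q.1 = none → q.2 = none}).preimage h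
  exact isCompact_iff_compactSpace.1 hc.isCompact

/-- The inclusion `v(T) ⊆ T₀`. -/
def ofVertex (v : Vertex) : Compactification :=
  ⟨fun n => v[n]?, fun n h => by
    rw [List.getElem?_eq_none_iff] at h ⊢
    omega⟩

/-! ### The algebra generated by the shift and the continuous functions -/

/-- The values of the shift: `(S ξ)(v) = ξ(par v)` for `v ≠ r`, and `(S ξ)(r) = 0`. -/
def shiftFun (ξ : Vertex → ℂ) (v : Vertex) : ℂ :=
  if v = [] then 0 else ξ v.dropLast

theorem hasSum_shiftFun (ξ : ℓ²(Vertex, ℂ)) :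
    HasSum (fun v => ‖shiftFun ξ v‖ ^ (2 : ENNReal).toReal)
      (2 * ‖ξ‖ ^ (2 : ENNReal).toReal) := by
  have hξ : HasSum (fun v => ‖ξ v‖ ^ (2 : ENNReal).toReal) (‖ξ‖ ^ (2 : ENNReal).toReal) :=
    lp.hasSum_norm (by norm_num) ξ
  let i : Bool × Vertex → Vertex := fun p => p.2 ++ [p.1]
  have hi : Function.Injective i := by
    rintro ⟨b, u⟩ ⟨c, w⟩ h
    have := List.append_inj' h rfl
    simp_all
  have h0 : ∀ v ∉ Set.range i, ‖shiftFun ξ v‖ ^ (2 : ENNReal).toReal = 0 := by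
    intro v hv
    have : v = [] := by
      by_contra h
      exact hv ⟨(v.getLast h, v.dropLast), List.dropLast_append_getLast h⟩
    simp [shiftFun, this]
  rw [← hi.hasSum_iff h0]
  have h1 : ((fun v => ‖shiftFun ξ v‖ ^ (2 : ENNReal).toReal) ∘ i) =
      fun p => ‖ξ p.2‖ ^ (2 : ENNReal).toReal := by
    funext p
    simp [i, shiftFun]
  rw [h1, ← (Equiv.boolProdEquivSum Vertex).symm.hasSum_iff, two_mul]
  exact HasSum.sum (by simpa [Function.comp_def] using hξ) (by simpa [Function.comp_def] using hξ)

/-- The shift operator `S` on `ℓ²(T)`. -/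
def shift : ℓ²(Vertex, ℂ) →L[ℂ] ℓ²(Vertex, ℂ) :=
  LinearMap.mkContinuous
    { toFun := fun ξ => ⟨shiftFun ξ, memℓp_gen (hasSum_shiftFun ξ).summable⟩
      map_add' := fun ξ η => by
        ext v
        change shiftFun (ξ + η) v = shiftFun ξ v + shiftFun η v
        by_cases h : v = [] <;> simp [shiftFun, h]
      map_smul' := fun c ξ => by
        ext v
        by_cases h : v = [] <;> simp [shiftFun, h] } (Real.sqrt 2) (fun ξ => by
      refine lp.norm_le_of_tsum_le (by norm_num) (by positivity) ?_
      refine (hasSum_shiftFun ξ).tsum_eq.trans_le (le_of_eq ?_)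
      simp [mul_pow])

@[simp]
theorem shift_apply (ξ : ℓ²(Vertex, ℂ)) (v : Vertex) :
    shift ξ v = if v = [] then 0 else ξ v.dropLast := rfl

theorem norm_mul_le (f : C(Compactification, ℂ)) (ξ : ℓ²(Vertex, ℂ)) (v : Vertex) :
    ‖f (ofVertex v) * ξ v‖ ≤ ‖((‖f‖ : ℂ) • ξ) v‖ := by
  rw [lp.coeFn_smul, Pi.smul_apply, norm_smul, norm_mul, Complex.norm_real, norm_norm]
  exact mul_le_mul_of_nonneg_right (f.norm_coe_le_norm (ofVertex v)) (norm_nonneg (ξ v))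

/-- The operator on `ℓ²(T)` of pointwise multiplication by `f ∈ C(T₀)`. -/
def mulOp (f : C(Compactification, ℂ)) : ℓ²(Vertex, ℂ) →L[ℂ] ℓ²(Vertex, ℂ) :=
  LinearMap.mkContinuous
    { toFun := fun ξ => ⟨fun v => f (ofVertex v) * ξ v,
        (lp.memℓp ((‖f‖ : ℂ) • ξ)).mono' (norm_mul_le f ξ)⟩
      map_add' := fun ξ η => by
        ext v
        exact mul_add _ _ _
      map_smul' := fun c ξ => by
        ext v
        simp [mul_left_comm] } ‖f‖ (fun ξ => by
      refine (lp.norm_mono (by norm_num) (norm_mul_le f ξ)).trans (le_of_eq ?_)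
      rw [norm_smul, Complex.norm_real, norm_norm])

@[simp]
theorem mulOp_apply (f : C(Compactification, ℂ)) (ξ : ℓ²(Vertex, ℂ)) (v : Vertex) :
    mulOp f ξ v = f (ofVertex v) * ξ v := rfl

/-- The C*-algebra `A` generated by the shift `S` and by `C(T₀)` on `ℓ²(T)`. -/
def treeAlgebra : StarSubalgebra ℂ (ℓ²(Vertex, ℂ) →L[ℂ] ℓ²(Vertex, ℂ)) :=
  (StarAlgebra.adjoin ℂ ({shift} ∪ Set.range mulOp)).topologicalClosure

end BinaryTree

end

/-!
The isometry `V = S / √2` is pure, and the vector `δ_r` at the root together with the normalised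
differences `(δ_{u0} - δ_{u1}) / √2`, over the vertices `u`, is an orthonormal basis of the kernel
of `V*`. Each of these kernel vectors `e_i` generates a copy `W_i ℓ²(ℕ)` of `ℓ²(ℕ)` inside `ℓ²(T)`,
spanned by the orthonormal vectors `V^n e_i`, and these copies are orthogonal (`woldIso`,
`orthogonalFamily_woldIso`). To a continuous function `F` on the boundary `K` with values in the
operators on `ℓ²(ℕ)` corresponds the operator `modelHom F = ∑ W_i F(x_i) W_i*` on `ℓ²(T)`, where
`x_i` is the boundary point obtained by continuing the word of the vertex of index `i` by the letter
`false`. This is a contractive `*`-homomorphism.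

Along the initial pieces `u` of a path `x` the compressions `W_u* k W_u` of a compact operator `k`
tend to zero, whereas those of `modelHom F` are the values `F(x_u)` and tend to `F(x)`. Hence
`‖F‖ ≤ ‖modelHom F + k‖` (`norm_le_norm_modelHom_add`). Therefore
`modelHom (𝒦(ℓ²(ℕ)) ⊗ C(K)) + 𝒦(ℓ²(T))` is a closed `*`-algebra, in which `F` is determined by
`modelHom F + k`, and `modelHom F + k ↦ F` is a `*`-homomorphism that makes the required sequence
exact, and indeed split (`isClosed_splitExtension`, `exact_splitExtension`).

It remains to see that this algebra is the commutator ideal (`commutatorIdeal_treeAlgebra`). Since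
`f(par v) - f(v)` vanishes at infinity for `f ∈ C(T₀)`, the shift commutes with multiplication
operators modulo compact operators. The only other commutator of generators is that of `S` and `S*`,
a multiple of the projection `1 - V V*`, which is the model operator of the constant function with
value the matrix unit `E₀₀`. Moreover `f (1 - V V*)` agrees modulo compact operators with the model
operator of `f|_K E₀₀`, because the compression of `f` to the kernel of `V*` is diagonal in the
basis `e_i` and its entry at `u` is the mean of `f` over the two children of `u`
(`mulOp_mul_modelUnit_zero_zero`). As the model operators of `f E_{mn}` are
`V^m modelHom (f E₀₀) V*^n`, the algebra absorbs the generators, so it contains the commutator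
ideal. Conversely, the commutator ideal contains these model operators, and it contains the compact
operators because the commutators of `S` with the indicator functions of the vertices produce all
matrix units of `ℓ²(T)` (`compacts_le_commutatorIdeal`).
-/

noncomputable section

namespace BinaryTree

open Filter Topology

/-! ### Compact operators -/

section Compact

variable {H : Type*} [NormedAddCommGroup H] [InnerProductSpace ℂ H] [CompleteSpace H]
  {E E' : Type*} [NormedAddCommGroup E] [InnerProductSpace ℂ E]
  [NormedAddCommGroup E'] [InnerProductSpace ℂ E']

theorem mem_compacts {T : H →L[ℂ] H} : T ∈ compacts H ↔ IsCompactOperator T := Iff.rfl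

theorem isClosed_compacts : IsClosed (compacts H : Set (H →L[ℂ] H)) :=
  isClosed_setOfPred_isCompactOperator

theorem mul_mem_compacts (S : H →L[ℂ] H) {T : H →L[ℂ] H} (hT : T ∈ compacts H) :
    S * T ∈ compacts H :=
  IsCompactOperator.clm_comp (mem_compacts.1 hT) S

theorem mem_compacts_mul {T : H →L[ℂ] H} (hT : T ∈ compacts H) (S : H →L[ℂ] H) :
    T * S ∈ compacts H :=
  IsCompactOperator.comp_clm (mem_compacts.1 hT) S

/-- A bounded family of operators that converges strongly to zero converges to zero uniformly on
compact sets, hence in norm after composition with a compact operator. -/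
theorem tendsto_norm_comp_compact {α : Type*} {l : Filter α} {B : α → E →L[ℂ] E'} {C : ℝ}
    (hC : ∀ a, ‖B a‖ ≤ C) (hB : ∀ η, Tendsto (fun a => B a η) l (𝓝 0)) {k : E →L[ℂ] E}
    (hk : IsCompactOperator k) : Tendsto (fun a => ‖B a ∘L k‖) l (𝓝 0) := by
  rw [Metric.tendsto_nhds]
  intro ε hε
  have hC1 : 0 < |C| + 1 := by positivity
  have hR : TotallyBounded (k '' Metric.closedBall 0 1) :=
    (((hk.isCompact_closure_image_closedBall
      (f := (k : E →ₗ[ℂ] E)) 1).totallyBounded)).subset subset_closure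
  obtain ⟨t, -, htf, ht⟩ := Metric.finite_approx_of_totallyBounded hR (ε / (4 * (|C| + 1)))
    (by positivity)
  have h1 : ∀ᶠ a in l, ∀ y ∈ t, ‖B a y‖ < ε / 4 := by
    rw [eventually_all_finite htf]
    intro y _
    have := (hB y).norm
    rw [norm_zero] at this
    exact this.eventually (gt_mem_nhds (by positivity))
  filter_upwards [h1] with a ha
  rw [dist_zero_right, norm_norm]
  refine (ContinuousLinearMap.opNorm_le_of_unit_norm (C := ε / 2) (by positivity) ?_).trans_lt
    (by linarith)
  intro x hx
  obtain ⟨y, hy, hxy⟩ := Set.mem_iUnion₂.1 (ht (Set.mem_image_of_mem k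
    (show x ∈ Metric.closedBall (0 : E) 1 by simp [hx])))
  rw [Metric.mem_ball, dist_eq_norm] at hxy
  have h2 : ‖B a (k x - y)‖ ≤ ε / 4 := by
    refine ((B a).le_of_opNorm_le ((hC a).trans ((le_abs_self C).trans
      (le_add_of_nonneg_right zero_le_one))) _).trans ?_
    calc (|C| + 1) * ‖k x - y‖ ≤ (|C| + 1) * (ε / (4 * (|C| + 1))) := by gcongr
      _ = ε / 4 := by field_simp
  have h3 : (B a ∘L k) x = B a (k x - y) + B a y := by simp
  rw [h3]
  exact (norm_add_le _ _).trans (by linarith [ha y hy])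

end Compact

/-! ### Matrix units -/

section MatrixUnit

variable {X : Type*} [DecidableEq X]

/-- The vector of the standard basis of `ℓ²(X)` at the point `x`. -/
def basisVec (x : X) : ℓ²(X, ℂ) := lp.single 2 x 1

/-- The matrix unit on `ℓ²(X)` that maps the basis vector at `y` to the one at `x`. -/
def matrixUnit (x y : X) : ℓ²(X, ℂ) →L[ℂ] ℓ²(X, ℂ) :=
  InnerProductSpace.rankOne ℂ (basisVec x) (basisVec y)

theorem basisVec_apply (x y : X) : (basisVec x : ℓ²(X, ℂ)) y = if y = x then 1 else 0 := by
  simp [basisVec, Pi.single_apply]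

theorem inner_basisVec (x : X) (ξ : ℓ²(X, ℂ)) : inner ℂ (basisVec x) ξ = ξ x := by
  rw [basisVec, lp.inner_single_left]
  simp

theorem matrixUnit_apply (x y : X) (ξ : ℓ²(X, ℂ)) : matrixUnit x y ξ = ξ y • basisVec x := by
  rw [matrixUnit, InnerProductSpace.rankOne_apply, inner_basisVec]

theorem star_matrixUnit (x y : X) : star (matrixUnit x y) = matrixUnit y x := by
  rw [ContinuousLinearMap.star_eq_adjoint, matrixUnit, InnerProductSpace.adjoint_rankOne,
    matrixUnit]

theorem matrixUnit_mul (x y z : X) : matrixUnit x y * matrixUnit y z = matrixUnit x z := by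
  ext1 ξ
  simp [matrixUnit_apply, basisVec_apply]

theorem matrixUnit_mem_compacts (x y : X) : matrixUnit x y ∈ compacts ℓ²(X, ℂ) := by
  rw [mem_compacts, matrixUnit, InnerProductSpace.rankOne_def']
  have h : IsCompactOperator (ContinuousLinearMap.toSpanSingleton ℂ (basisVec x)) :=
    isCompactOperator_of_locallyCompactSpace_rng
      (ContinuousLinearMap.toSpanSingleton ℂ (basisVec x))
  exact h.comp_clm _

/-- The coordinate projection of `ℓ²(X)` that belongs to a finite set. -/
def coordProj (s : Finset X) : ℓ²(X, ℂ) →L[ℂ] ℓ²(X, ℂ) := ∑ x ∈ s, matrixUnit x x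

theorem tendsto_coordProj (ξ : ℓ²(X, ℂ)) :
    Tendsto (fun s => (1 - coordProj s) ξ) atTop (𝓝 0) := by
  have h := lp.hasSum_single (p := 2) (by simp) ξ
  rw [HasSum] at h
  have h2 := h.const_sub ξ
  simp only [sub_self, SummationFilter.unconditional_filter] at h2
  refine h2.congr fun s => ?_
  simp only [_root_.sub_apply, one_apply_eq_self, coordProj,
    _root_.sum_apply, matrixUnit_apply]
  congr 1
  refine Finset.sum_congr rfl fun x _ => ?_
  rw [basisVec, ← lp.single_smul]
  simp

theorem norm_one_sub_coordProj_le (s : Finset X) : ‖1 - coordProj (X := X) s‖ ≤ 1 := by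
  refine ContinuousLinearMap.opNorm_le_bound _ zero_le_one fun ξ => ?_
  rw [one_mul]
  refine lp.norm_mono (by norm_num) fun x => ?_
  have : ((1 - coordProj s) ξ) x = if x ∈ s then 0 else ξ x := by
    simp only [_root_.sub_apply, one_apply_eq_self, coordProj,
      _root_.sum_apply, matrixUnit_apply, lp.coeFn_sub, lp.coeFn_sum, Pi.sub_apply,
      Finset.sum_apply, lp.coeFn_smul, Pi.smul_apply, basisVec_apply]
    split_ifs with h <;> simp [h]
  rw [this]
  split_ifs <;> simp

/-- The matrix units span a dense subspace of the compact operators on `ℓ²(X)`. -/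
theorem compact_mem_of_matrixUnit_mem {M : Submodule ℂ (ℓ²(X, ℂ) →L[ℂ] ℓ²(X, ℂ))}
    (hM : IsClosed (M : Set (ℓ²(X, ℂ) →L[ℂ] ℓ²(X, ℂ)))) (h : ∀ x y, matrixUnit x y ∈ M)
    {T : ℓ²(X, ℂ) →L[ℂ] ℓ²(X, ℂ)} (hT : T ∈ compacts ℓ²(X, ℂ)) : T ∈ M := by
  -- The corner `p T p` of `T` at a finite coordinate projection `p` converges to `T` in norm,
  -- as both `(1 - p) T` and `(1 - p) T*` converge to zero.
  have h1 := tendsto_norm_comp_compact norm_one_sub_coordProj_le tendsto_coordProj hT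
  have h2 := tendsto_norm_comp_compact norm_one_sub_coordProj_le tendsto_coordProj
    (star_mem hT : star T ∈ compacts _)
  have hstar : ∀ s : Finset X, star (coordProj s) = coordProj s := fun s => by
    simp [coordProj, star_sum, star_matrixUnit]
  have h3 := h2.add (h1.mul_const (1 + ‖(1 : ℓ²(X, ℂ) →L[ℂ] ℓ²(X, ℂ))‖))
  rw [zero_mul, zero_add] at h3
  have hlim : Tendsto (fun s : Finset X => coordProj s * T * coordProj s) atTop (𝓝 T) := by
    rw [tendsto_iff_norm_sub_tendsto_zero]
    refine squeeze_zero (fun _ => norm_nonneg _) (fun s => ?_) h3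
    have e : coordProj s * T * coordProj s - T =
        - (star ((1 - coordProj s) * star T) +
          (1 - coordProj s) * T * (1 - (1 - coordProj s))) := by
      simp only [star_mul, star_sub, star_star, star_one, hstar]
      noncomm_ring
    rw [e, norm_neg]
    refine (norm_add_le _ _).trans (add_le_add (norm_star ((1 - coordProj s) * star T)).le ?_)
    refine (_root_.norm_mul_le _ _).trans ?_
    refine mul_le_mul_of_nonneg_left ?_ (norm_nonneg _)
    refine (norm_sub_le _ _).trans ?_
    rw [add_comm]
    exact add_le_add_left (norm_one_sub_coordProj_le s) _
  refine hM.mem_of_tendsto hlim (Eventually.of_forall fun s => ?_)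
  simp only [coordProj, Finset.sum_mul, Finset.mul_sum]
  refine sum_mem fun x _ => sum_mem fun y _ => ?_
  have : matrixUnit y y * T * matrixUnit x x = (T (basisVec x) y) • matrixUnit y x := by
    ext1 ξ
    simp [matrixUnit_apply, mul_comm, smul_smul]
  rw [this]
  exact M.smul_mem _ (h _ _)

end MatrixUnit

/-! ### Block diagonal operators -/

section BlockDiagonal

variable {ι E H : Type*} [NormedAddCommGroup E] [InnerProductSpace ℂ E] [CompleteSpace E]
  [NormedAddCommGroup H] [InnerProductSpace ℂ H] [CompleteSpace H]

theorem norm_blockDiag_apply_le (F : lp (fun _ : ι => E →L[ℂ] E) ⊤) (ξ : lp (fun _ : ι => E) 2)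
    (i : ι) : ‖F i (ξ i)‖ ≤ ‖((‖F‖ : ℂ) • ξ) i‖ := by
  rw [lp.coeFn_smul, Pi.smul_apply, norm_smul, Complex.norm_real, norm_norm]
  exact (F i).le_of_opNorm_le (lp.norm_apply_le_norm (by simp) F i) _

/-- The block diagonal operator on the Hilbert sum of copies of `E` given by a bounded family of
operators on `E`. -/
def blockDiag (F : lp (fun _ : ι => E →L[ℂ] E) ⊤) :
    lp (fun _ : ι => E) 2 →L[ℂ] lp (fun _ : ι => E) 2 :=
  LinearMap.mkContinuous
    { toFun := fun ξ => ⟨fun i => F i (ξ i),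
        (lp.memℓp ((‖F‖ : ℂ) • ξ)).mono' (norm_blockDiag_apply_le F ξ)⟩
      map_add' := fun ξ η => by
        ext i
        exact map_add _ _ _
      map_smul' := fun c ξ => by
        ext i
        exact map_smul _ _ _ } ‖F‖ (fun ξ => by
      refine (lp.norm_mono (by norm_num) (norm_blockDiag_apply_le F ξ)).trans (le_of_eq ?_)
      rw [norm_smul, Complex.norm_real, norm_norm])

@[simp]
theorem blockDiag_apply (F : lp (fun _ : ι => E →L[ℂ] E) ⊤) (ξ : lp (fun _ : ι => E) 2) (i : ι) :
    blockDiag F ξ i = F i (ξ i) := rfl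

theorem norm_blockDiag_le (F : lp (fun _ : ι => E →L[ℂ] E) ⊤) : ‖blockDiag F‖ ≤ ‖F‖ :=
  LinearMap.mkContinuous_norm_le _ (norm_nonneg _) _

theorem blockDiag_single [DecidableEq ι] (F : lp (fun _ : ι => E →L[ℂ] E) ⊤) (i : ι) (x : E) :
    blockDiag F (lp.single 2 i x) = lp.single 2 i (F i x) := by
  ext j
  rw [blockDiag_apply, lp.single_apply, lp.single_apply]
  rcases eq_or_ne j i with rfl | h
  · simp
  · simp [h]

/-- A block diagonal operator is compact if its blocks are compact and tend to zero in norm. -/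
theorem isCompactOperator_blockDiag {F : lp (fun _ : ι => E →L[ℂ] E) ⊤}
    (hF : ∀ i, IsCompactOperator (F i)) (h0 : Tendsto (fun i => ‖F i‖) cofinite (𝓝 0)) :
    IsCompactOperator (blockDiag F) := by
  classical
  -- The operator is the norm limit of its finite truncations.
  refine isClosed_setOfPred_isCompactOperator.closure_subset
    (Metric.mem_closure_iff.2 fun ε hε => ?_)
  have hfin := eventually_cofinite.1 (h0.eventually (gt_mem_nhds (half_pos hε)))
  let R : lp (fun _ : ι => E) 2 →L[ℂ] lp (fun _ : ι => E) 2 := ∑ i ∈ hfin.toFinset,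
    lp.singleContinuousLinearMap ℂ (fun _ : ι => E) 2 i ∘L F i ∘L lp.evalCLM ℂ (fun _ : ι => E) 2 i
  refine ⟨R, ?_, ?_⟩
  · have : R ∈ compactOperator (RingHom.id ℂ) (lp (fun _ : ι => E) 2) (lp (fun _ : ι => E) 2) :=
      sum_mem fun i _ => ((hF i).comp_clm (lp.evalCLM ℂ (fun _ : ι => E) 2 i)).clm_comp
        (lp.singleContinuousLinearMap ℂ (fun _ : ι => E) 2 i)
    exact this
  · rw [dist_eq_norm]
    refine (ContinuousLinearMap.opNorm_le_bound _ (half_pos hε).le fun ξ => ?_).trans_lt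
      (half_lt_self hε)
    have hn : ‖((ε / 2 : ℝ) : ℂ) • ξ‖ = ε / 2 * ‖ξ‖ := by
      rw [norm_smul, Complex.norm_real, Real.norm_of_nonneg (half_pos hε).le]
    rw [← hn]
    refine lp.norm_mono (by norm_num) fun j => ?_
    have hR : (R ξ) j = if j ∈ hfin.toFinset then F j (ξ j) else 0 := by
      simp only [R, _root_.sum_apply, lp.coeFn_sum, Finset.sum_apply,
        ContinuousLinearMap.comp_apply, lp.singleContinuousLinearMap_apply, lp.single_apply]
      simp [Pi.single_apply, lp.evalCLM]
    rw [_root_.sub_apply, lp.coeFn_sub, Pi.sub_apply, hR, blockDiag_apply, lp.coeFn_smul,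
      Pi.smul_apply, norm_smul, Complex.norm_real, Real.norm_of_nonneg (half_pos hε).le]
    split_ifs with hj
    · rw [sub_self, norm_zero]
      positivity
    · rw [sub_zero]
      refine (F j).le_of_opNorm_le ?_ _
      simpa using (not_not.1 (mt (fun h => hfin.mem_toFinset.2 h) hj) : ‖F j‖ < ε / 2).le

variable {V : ι → E →ₗᵢ[ℂ] H} (hV : OrthogonalFamily ℂ (fun _ : ι => E) V)

/-- For isometries `V i` with orthogonal ranges, the operator `∑ V i ∘ F i ∘ (V i)†`. -/
def blockOp (F : lp (fun _ : ι => E →L[ℂ] E) ⊤) : H →L[ℂ] H :=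
  hV.linearIsometry.toContinuousLinearMap ∘L blockDiag F ∘L
    hV.linearIsometry.toContinuousLinearMap.adjoint

theorem adjoint_linearIsometry_apply (η : H) (i : ι) :
    hV.linearIsometry.toContinuousLinearMap.adjoint η i =
      (V i).toContinuousLinearMap.adjoint η := by
  classical
  refine ext_inner_left ℂ fun x : E => ?_
  refine (lp.inner_single_left (𝕜 := ℂ) (G := fun _ : ι => E) i x _).symm.trans ?_
  rw [ContinuousLinearMap.adjoint_inner_right,
    ContinuousLinearMap.adjoint_inner_right]
  simp

theorem adjoint_comp_linearIsometry :
    hV.linearIsometry.toContinuousLinearMap.adjoint ∘L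
      hV.linearIsometry.toContinuousLinearMap = 1 := by
  rw [← ContinuousLinearMap.isometry_iff_adjoint_comp_self]
  exact hV.linearIsometry.isometry

theorem tendsto_adjoint_apply (hV : OrthogonalFamily ℂ (fun _ : ι => E) V) (η : H) :
    Tendsto (fun i => (V i).toContinuousLinearMap.adjoint η) cofinite (𝓝 0) := by
  simp only [← adjoint_linearIsometry_apply hV]
  rw [tendsto_zero_iff_norm_tendsto_zero]
  have h := (lp.hasSum_norm (p := 2) (by norm_num)
    (hV.linearIsometry.toContinuousLinearMap.adjoint η)).summable.tendsto_cofinite_zero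
  have h2 := h.sqrt
  simpa using h2

theorem norm_blockOp_le (F : lp (fun _ : ι => E →L[ℂ] E) ⊤) : ‖blockOp hV F‖ ≤ ‖F‖ := by
  have h1 : ‖hV.linearIsometry.toContinuousLinearMap‖ ≤ 1 :=
    hV.linearIsometry.norm_toContinuousLinearMap_le
  have h2 : ‖hV.linearIsometry.toContinuousLinearMap.adjoint‖ ≤ 1 := by
    rwa [LinearIsometryEquiv.norm_map]
  calc ‖blockOp hV F‖ ≤ 1 * (‖F‖ * 1) :=
        (ContinuousLinearMap.opNorm_comp_le _ _).trans (mul_le_mul h1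
          ((ContinuousLinearMap.opNorm_comp_le _ _).trans
            (mul_le_mul (norm_blockDiag_le F) h2 (norm_nonneg _) (norm_nonneg _)))
          (norm_nonneg _) zero_le_one)
    _ = ‖F‖ := by ring

theorem isCompactOperator_blockOp {F : lp (fun _ : ι => E →L[ℂ] E) ⊤}
    (hF : ∀ i, IsCompactOperator (F i)) (h0 : Tendsto (fun i => ‖F i‖) cofinite (𝓝 0)) :
    IsCompactOperator (blockOp hV F) :=
  ((isCompactOperator_blockDiag hF h0).comp_clm
    hV.linearIsometry.toContinuousLinearMap.adjoint).clm_comp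
      hV.linearIsometry.toContinuousLinearMap

theorem blockOp_apply_apply (F : lp (fun _ : ι => E →L[ℂ] E) ⊤) (i : ι) (x : E) :
    blockOp hV F (V i x) = V i (F i x) := by
  classical
  have h : hV.linearIsometry.toContinuousLinearMap.adjoint (V i x) = lp.single 2 i x := by
    rw [← hV.linearIsometry_apply_single]
    exact congrArg (fun T => T (lp.single 2 i x)) (adjoint_comp_linearIsometry hV)
  simp only [blockOp, ContinuousLinearMap.comp_apply, h, blockDiag_single]
  simp

/-- The values of two block operators agree if their components in each summand agree. -/
theorem blockOp_apply_congr {F G : lp (fun _ : ι => E →L[ℂ] E) ⊤} {ξ η : H}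
    (h : ∀ i, F i ((V i).toContinuousLinearMap.adjoint ξ) =
      G i ((V i).toContinuousLinearMap.adjoint η)) : blockOp hV F ξ = blockOp hV G η := by
  simp only [blockOp, ContinuousLinearMap.comp_apply]
  congr 1
  ext i
  rw [blockDiag_apply, blockDiag_apply, adjoint_linearIsometry_apply, adjoint_linearIsometry_apply,
    h]

/-- The map `F ↦ ∑ V i ∘ F i ∘ (V i)†` as a `*`-homomorphism on bounded families. -/
def blockHom : lp (fun _ : ι => E →L[ℂ] E) ⊤ →⋆ₙₐ[ℂ] (H →L[ℂ] H) where
  toFun := blockOp hV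
  map_smul' c F := by
    ext1 ξ
    simp only [blockOp, ContinuousLinearMap.comp_apply, MonoidHom.id_apply, _root_.smul_apply]
    rw [← map_smul]
    congr 1
  map_zero' := by
    ext1 ξ
    simp only [blockOp, ContinuousLinearMap.comp_apply, _root_.zero_apply]
    rw [← map_zero hV.linearIsometry.toContinuousLinearMap]
    congr 1
  map_add' F G := by
    ext1 ξ
    simp only [blockOp, ContinuousLinearMap.comp_apply, _root_.add_apply]
    rw [← map_add]
    congr 1
  map_mul' F G := by
    ext1 ξ
    have h := fun x => congrArg (fun T => T x) (adjoint_comp_linearIsometry hV)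
    simp only [ContinuousLinearMap.comp_apply, one_apply_eq_self] at h
    simp only [blockOp, ContinuousLinearMap.comp_apply, mul_apply_eq_comp, h]
    congr 1
  map_star' F := by
    rw [ContinuousLinearMap.star_eq_adjoint]
    have h : blockDiag (star F) = (blockDiag F).adjoint := by
      rw [ContinuousLinearMap.eq_adjoint_iff]
      intro x y
      rw [lp.inner_eq_tsum, lp.inner_eq_tsum]
      refine tsum_congr fun i => ?_
      rw [blockDiag_apply, blockDiag_apply, lp.star_apply, ContinuousLinearMap.star_eq_adjoint,
        ContinuousLinearMap.adjoint_inner_left]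
    simp only [blockOp, h, ContinuousLinearMap.adjoint_comp, ContinuousLinearMap.adjoint_adjoint,
      ContinuousLinearMap.comp_assoc]

theorem blockHom_apply (F : lp (fun _ : ι => E →L[ℂ] E) ⊤) : blockHom hV F = blockOp hV F := rfl

end BlockDiagonal

/-! ### Commutator ideals in terms of generators -/

section Generators

variable {B : Type*} [CStarAlgebra B]

theorem commutatorSet_subset (A : StarSubalgebra ℂ B) :
    commutatorSet A ⊆ commutatorIdeal A := fun _ hT =>
  subset_closure (Submodule.subset_span hT)

theorem commutator_mem_commutatorIdeal {A : StarSubalgebra ℂ B} {a b : B} (ha : a ∈ A)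
    (hb : b ∈ A) : a * b - b * a ∈ commutatorIdeal A :=
  commutatorSet_subset A ⟨1, one_mem A, a, ha, b, hb, 1, one_mem A, by simp⟩

theorem isClosed_commutatorIdeal (A : StarSubalgebra ℂ B) :
    IsClosed (commutatorIdeal A : Set B) := isClosed_closure

theorem mul_mem_commutatorIdeal {A : StarSubalgebra ℂ B} {a T : B} (ha : a ∈ A)
    (hT : T ∈ commutatorIdeal A) : a * T ∈ commutatorIdeal A := by
  refine map_mem_closure (f := fun T => a * T) (continuous_const_mul a) hT fun T hT => ?_
  change a * T ∈ Submodule.span ℂ (commutatorSet A)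
  refine Submodule.span_induction (p := fun T _ => a * T ∈ Submodule.span ℂ (commutatorSet A))
    ?_ ?_ ?_ ?_ hT
  · rintro _ ⟨x, hx, c, hc, d, hd, y, hy, rfl⟩
    exact Submodule.subset_span ⟨a * x, mul_mem ha hx, c, hc, d, hd, y, hy, by
      simp only [mul_assoc]⟩
  · simp
  · intro S T _ _ h h'
    rw [mul_add]
    exact add_mem h h'
  · intro c S _ h
    rw [mul_smul_comm]
    exact Submodule.smul_mem _ c h

theorem mem_commutatorIdeal_mul {A : StarSubalgebra ℂ B} {a T : B} (hT : T ∈ commutatorIdeal A)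
    (ha : a ∈ A) : T * a ∈ commutatorIdeal A := by
  have := star_mem (mul_mem_commutatorIdeal (star_mem ha) (star_mem hT))
  simpa using this

variable {J : NonUnitalStarSubalgebra ℂ B} {X : Set B}

/-- A closed `*`-subalgebra that absorbs the generators of a C*-algebra on the left is a two-sided
ideal for the whole C*-algebra. -/
theorem mul_mem_of_generators (hJ : IsClosed (J : Set B))
    (h : ∀ x ∈ X, ∀ T ∈ J, x * T ∈ J ∧ star x * T ∈ J) {a : B}
    (ha : a ∈ (StarAlgebra.adjoin ℂ X).topologicalClosure) :
    ∀ T ∈ J, a * T ∈ J ∧ T * a ∈ J := by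
  have key : ∀ a ∈ StarAlgebra.adjoin ℂ X, ∀ T ∈ J, a * T ∈ J ∧ star a * T ∈ J := by
    intro a ha
    induction ha using StarAlgebra.adjoin_induction with
    | mem x hx => exact h x hx
    | algebraMap r =>
      intro T hT
      rw [← algebraMap_star_comm, ← Algebra.smul_def, ← Algebra.smul_def]
      exact ⟨SMulMemClass.smul_mem r hT, SMulMemClass.smul_mem _ hT⟩
    | add x y _ _ hx hy =>
      intro T hT
      rw [star_add, add_mul, add_mul]
      exact ⟨add_mem (hx T hT).1 (hy T hT).1, add_mem (hx T hT).2 (hy T hT).2⟩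
    | mul x y _ _ hx hy =>
      intro T hT
      rw [star_mul, mul_assoc, mul_assoc]
      exact ⟨(hx _ (hy T hT).1).1, (hy _ (hx T hT).2).2⟩
    | star x _ hx =>
      intro T hT
      rw [star_star]
      exact (hx T hT).symm
  have hl : ∀ a ∈ (StarAlgebra.adjoin ℂ X).topologicalClosure, ∀ T ∈ J, a * T ∈ J := by
    intro a ha T hT
    exact hJ.closure_subset (map_mem_closure (f := fun a => a * T) (continuous_mul_const T) ha
      fun a ha => (key a ha T hT).1)
  refine fun T hT => ⟨hl a ha T hT, ?_⟩
  have := star_mem (hl (star a) (star_mem ha) (star T) (star_mem hT))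
  simpa using this

/-- If the generators of a C*-algebra commute, with one another and with their adjoints, modulo a
closed ideal, then the ideal contains the commutator ideal. -/
theorem commutatorIdeal_le_of_generators (hJ : IsClosed (J : Set B))
    (h : ∀ x ∈ X, ∀ T ∈ J, x * T ∈ J ∧ star x * T ∈ J)
    (hc : ∀ x ∈ X, ∀ y ∈ X, x * y - y * x ∈ J ∧ x * star y - star y * x ∈ J) :
    commutatorIdeal (StarAlgebra.adjoin ℂ X).topologicalClosure ≤ J := by
  have hi : ∀ a ∈ StarAlgebra.adjoin ℂ X, ∀ T ∈ J, a * T ∈ J ∧ T * a ∈ J := fun a ha =>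
    mul_mem_of_generators hJ h (subset_closure ha)
  -- The commutant modulo `J` of a self-adjoint set is a `*`-algebra.
  have key : ∀ Y : Set B, (∀ y ∈ Y, star y ∈ Y) →
      (∀ x ∈ X, ∀ y ∈ Y, x * y - y * x ∈ J) →
      ∀ a ∈ StarAlgebra.adjoin ℂ X, ∀ y ∈ Y, a * y - y * a ∈ J := by
    intro Y hY hXY a ha
    induction ha using StarAlgebra.adjoin_induction with
    | mem x hx => exact hXY x hx
    | algebraMap r =>
      intro y _
      rw [Algebra.commutes, sub_self]
      exact zero_mem J
    | add a b _ _ hx hy =>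
      intro y hyY
      have e : (a + b) * y - y * (a + b) = (a * y - y * a) + (b * y - y * b) := by noncomm_ring
      rw [e]
      exact add_mem (hx y hyY) (hy y hyY)
    | mul a b ha hb hx hy =>
      intro y hyY
      have e : a * b * y - y * (a * b) = a * (b * y - y * b) + (a * y - y * a) * b := by
        noncomm_ring
      rw [e]
      exact add_mem (hi a ha _ (hy y hyY)).1 (hi b hb _ (hx y hyY)).2
    | star a _ hx =>
      intro y hyY
      have := neg_mem (star_mem (hx (star y) (hY y hyY)))
      simpa using this
  have h1 : ∀ x ∈ X, ∀ a ∈ StarAlgebra.adjoin ℂ X, x * a - a * x ∈ J := by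
    intro x hx a ha
    have := neg_mem (key (X ∪ star '' X) (by
      rintro y (hy | ⟨y, hy, rfl⟩)
      · exact Or.inr ⟨y, hy, rfl⟩
      · exact Or.inl (by simpa using hy)) (by
      rintro x hx y (hy | ⟨y, hy, rfl⟩)
      · exact (hc x hx y hy).1
      · exact (hc x hx y hy).2) a ha x (Or.inl hx))
    simpa using this
  have h2 := key (StarAlgebra.adjoin ℂ X : Set B) (fun _ hy => star_mem hy) h1
  have h3 : ∀ a ∈ (StarAlgebra.adjoin ℂ X).topologicalClosure,
      ∀ b ∈ (StarAlgebra.adjoin ℂ X).topologicalClosure, a * b - b * a ∈ J := by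
    intro a ha b hb
    exact hJ.closure_subset (map_mem_closure₂ (f := fun a b => a * b - b * a) (by fun_prop) ha hb
      fun a ha b hb => h2 a ha b hb)
  refine closure_minimal ?_ hJ
  intro T hT
  refine Submodule.span_induction (p := fun T _ => T ∈ J) ?_ (zero_mem J)
    (fun _ _ _ _ => add_mem) (fun c _ _ h => SMulMemClass.smul_mem c h) hT
  rintro _ ⟨x, hx, a, ha, b, hb, y, hy, rfl⟩
  exact (mul_mem_of_generators hJ h hy _ (mul_mem_of_generators hJ h hx _ (h3 a ha b hb)).1).2

end Generators

/-! ### Split extensions by the compact operators -/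

section SplitExtension

variable {H E X : Type*} [NormedAddCommGroup H] [InnerProductSpace ℂ H] [CompleteSpace H]
  [NormedAddCommGroup E] [InnerProductSpace ℂ E] [CompleteSpace E]
  [TopologicalSpace X]
  (D : NonUnitalStarSubalgebra ℂ C(X, E →L[ℂ] E)) (L : C(X, E →L[ℂ] E) →⋆ₙₐ[ℂ] (H →L[ℂ] H))

/-- The algebra `L(D) + 𝒦(H)` for a `*`-homomorphism `L`. -/
def splitExtension : NonUnitalStarSubalgebra ℂ (H →L[ℂ] H) where
  carrier := {T | ∃ F ∈ D, ∃ k ∈ compacts H, T = L F + k}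
  add_mem' := by
    rintro _ _ ⟨F, hF, k, hk, rfl⟩ ⟨G, hG, l, hl, rfl⟩
    exact ⟨F + G, add_mem hF hG, k + l, add_mem hk hl, by rw [map_add]; abel⟩
  zero_mem' := ⟨0, zero_mem D, 0, zero_mem (compacts H), by simp⟩
  smul_mem' := by
    rintro c _ ⟨F, hF, k, hk, rfl⟩
    exact ⟨c • F, SMulMemClass.smul_mem c hF, c • k, SMulMemClass.smul_mem c hk, by
      rw [map_smul, smul_add]⟩
  mul_mem' := by
    rintro _ _ ⟨F, hF, k, hk, rfl⟩ ⟨G, hG, l, hl, rfl⟩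
    refine ⟨F * G, mul_mem hF hG, L F * l + k * L G + k * l,
      add_mem (add_mem (mul_mem_compacts _ hl) (mem_compacts_mul hk _)) (mul_mem hk hl), by
        rw [map_mul]
        noncomm_ring⟩
  star_mem' := by
    rintro _ ⟨F, hF, k, hk, rfl⟩
    exact ⟨star F, star_mem hF, star k, star_mem hk, by rw [map_star, star_add]⟩

variable {D L}

theorem isClosed_splitExtension [CompactSpace X]
    (hDc : IsClosed (D : Set C(X, E →L[ℂ] E))) (hL : ∀ F, ‖L F‖ ≤ ‖F‖)
    (hLK : ∀ F, ∀ k ∈ compacts H, ‖F‖ ≤ ‖L F + k‖) :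
    IsClosed (splitExtension D L : Set (H →L[ℂ] H)) := by
  -- The bound `‖F‖ ≤ ‖L F + k‖` makes the components of a Cauchy sequence Cauchy sequences.
  refine isClosed_of_closure_subset fun T hT => ?_
  obtain ⟨t, ht, hlim⟩ := mem_closure_iff_seq_limit.1 hT
  choose F hF k hk e using ht
  have hcau : CauchySeq F := by
    refine Metric.cauchySeq_iff'.2 fun ε hε => ?_
    obtain ⟨N, hN⟩ := Metric.cauchySeq_iff'.1 hlim.cauchySeq ε hε
    refine ⟨N, fun n hn => lt_of_le_of_lt ?_ (hN n hn)⟩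
    rw [dist_eq_norm, dist_eq_norm]
    refine (hLK _ _ (sub_mem (hk n) (hk N))).trans (le_of_eq ?_)
    rw [e, e, map_sub]
    congr 1
    abel
  obtain ⟨F₀, hF₀⟩ := cauchySeq_tendsto_of_complete hcau
  have hLc : Tendsto (fun n => L (F n)) atTop (𝓝 (L F₀)) := by
    rw [tendsto_iff_norm_sub_tendsto_zero] at hF₀ ⊢
    refine squeeze_zero (fun _ => norm_nonneg _) (fun n => ?_) hF₀
    rw [← map_sub]
    exact hL _
  refine ⟨F₀, hDc.mem_of_tendsto hF₀ (Eventually.of_forall hF), T - L F₀,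
    isClosed_compacts.mem_of_tendsto (hlim.sub hLc) (Eventually.of_forall fun n => ?_), by abel⟩
  rw [e, add_sub_cancel_left]
  exact hk n

/-- If `L F` is compact only for `F = 0`, then `L F + k ↦ F` is a well-defined `*`-homomorphism, and
it makes the sequence `𝒦(H) → L(D) + 𝒦(H) → D` exact. -/
theorem exact_splitExtension (hLK : ∀ F, L F ∈ compacts H → F = 0) :
    ∃ (h : compacts H ≤ splitExtension D L) (π : splitExtension D L →⋆ₙₐ[ℂ] D),
      Function.Injective (NonUnitalStarSubalgebra.inclusion h) ∧
      Function.Exact (NonUnitalStarSubalgebra.inclusion h) π ∧ Function.Surjective π := by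
  have h : compacts H ≤ splitExtension D L := fun k hk => ⟨0, zero_mem D, k, hk, by simp⟩
  have hu : ∀ {F G : C(X, E →L[ℂ] E)}, L F - L G ∈ compacts H → F = G := fun {F G} hFG =>
    sub_eq_zero.1 (hLK _ (by rwa [map_sub]))
  have hex : ∀ T : splitExtension D L, ∃ F : D, (T : H →L[ℂ] H) - L F ∈ compacts H := by
    rintro ⟨_, F, hF, k, hk, rfl⟩
    exact ⟨⟨F, hF⟩, by simpa using hk⟩
  choose p hp using hex
  have huniq : ∀ (T : splitExtension D L) (F : D),
      (T : H →L[ℂ] H) - L F ∈ compacts H → p T = F := by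
    intro T F hF
    refine Subtype.ext (hu ?_)
    have := sub_mem hF (hp T)
    simpa using this
  let π : splitExtension D L →⋆ₙₐ[ℂ] D :=
    { toFun := p
      map_smul' := fun c T => huniq _ _ (by
        have := SMulMemClass.smul_mem c (hp T)
        simpa [smul_sub] using this)
      map_zero' := huniq _ _ (by simp)
      map_add' := fun S T => huniq _ _ (by
        have := add_mem (hp S) (hp T)
        simp only [NonUnitalStarSubalgebra.coe_add, map_add]
        rwa [add_sub_add_comm])
      map_mul' := fun S T => huniq _ _ (by
        have h1 := mul_mem_compacts (L (p S)) (hp T)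
        have h2 := mem_compacts_mul (hp S) (L (p T))
        have h3 := mul_mem (hp S) (hp T)
        have h4 := add_mem (add_mem h1 h2) h3
        convert! h4 using 1
        simp only [NonUnitalStarSubalgebra.coe_mul, map_mul]
        noncomm_ring)
      map_star' := fun T => huniq _ _ (by
        have := star_mem (hp T)
        rw [star_sub, ← map_star] at this
        exact this) }
  refine ⟨h, π, ?_, ?_, ?_⟩
  · intro x y hxy
    exact Subtype.ext (congrArg (fun z : splitExtension D L => (z : H →L[ℂ] H)) hxy)
  · intro T
    constructor
    · intro hT
      have h1 := hp T
      have h2 : p T = 0 := hT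
      rw [h2] at h1
      refine ⟨⟨T, by simpa using h1⟩, Subtype.ext rfl⟩
    · rintro ⟨k, rfl⟩
      exact huniq _ 0 (by simp)
  · intro F
    exact ⟨⟨L F, F, F.2, 0, zero_mem (compacts H), by simp⟩, huniq _ F (by simp)⟩

theorem exact_of_commutatorIdeal_eq [CompactSpace X] {A : StarSubalgebra ℂ (H →L[ℂ] H)}
    {N : NonUnitalStarSubalgebra ℂ (E →L[ℂ] E)}
    (hA : commutatorIdeal A = splitExtension (tensorContinuous N X) L)
    (hLK : ∀ F, L F ∈ compacts H → F = 0) :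
    ∃ (h : compacts H ≤ commutatorIdeal A)
      (π : commutatorIdeal A →⋆ₙₐ[ℂ] tensorContinuous N X),
      Function.Injective (NonUnitalStarSubalgebra.inclusion h) ∧
      Function.Exact (NonUnitalStarSubalgebra.inclusion h) π ∧ Function.Surjective π := by
  rw [hA]
  exact exact_splitExtension hLK

/-- A contractive `*`-homomorphism, as a continuous linear map. -/
def contractionCLM [CompactSpace X] (L : C(X, E →L[ℂ] E) →⋆ₙₐ[ℂ] (H →L[ℂ] H))
    (hL : ∀ F, ‖L F‖ ≤ ‖F‖) : C(X, E →L[ℂ] E) →L[ℂ] H →L[ℂ] H :=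
  LinearMap.mkContinuous
    { toFun := L
      map_add' := map_add L
      map_smul' := map_smul L } 1 fun F => by
    rw [one_mul]
    exact hL F

/-- The elementary tensors span a dense subspace of the tensor product. -/
theorem mem_of_mem_tensorContinuous [CompactSpace X] {N : NonUnitalStarSubalgebra ℂ (E →L[ℂ] E)}
    {M : Submodule ℂ C(X, E →L[ℂ] E)} (hM : IsClosed (M : Set C(X, E →L[ℂ] E)))
    (h : ∀ k ∈ N, ∀ (f : C(X, ℂ)) (F : C(X, E →L[ℂ] E)), (∀ x, F x = f x • k) → F ∈ M)
    {F : C(X, E →L[ℂ] E)} (hF : F ∈ tensorContinuous N X) : F ∈ M := by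
  refine closure_minimal (fun F hF => ?_) hM hF
  set s : Set C(X, E →L[ℂ] E) := {F | ∃ k ∈ N, ∃ f : C(X, ℂ), ∀ x, F x = f x • k} with hs
  have hmul : ∀ F ∈ s, ∀ G ∈ s, F * G ∈ s := by
    rintro F ⟨k, hk, f, hf⟩ G ⟨l, hl, g, hg⟩
    refine ⟨k * l, mul_mem hk hl, f * g, fun x => ?_⟩
    rw [ContinuousMap.mul_apply, hf, hg, smul_mul_smul_comm, ContinuousMap.mul_apply]
  have hstar : star s ⊆ s := by
    rintro F ⟨k, hk, f, hf⟩
    refine ⟨star k, star_mem hk, star f, fun x => ?_⟩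
    have := congrArg star (hf x)
    rw [← ContinuousMap.star_apply, star_star, star_smul] at this
    exact this
  have hcl : (Subsemigroup.closure (s ∪ star s) : Set C(X, E →L[ℂ] E)) ⊆ s := by
    intro F hF
    induction hF using Subsemigroup.closure_induction with
    | mem F hF => exact hF.elim id fun h => hstar h
    | mul F G _ _ hF hG => exact hmul F hF G hG
  have hF' : F ∈ Submodule.span ℂ (Subsemigroup.closure (s ∪ star s) : Set C(X, E →L[ℂ] E)) := by
    rw [← NonUnitalStarAlgebra.adjoin_eq_span]
    exact hF
  refine Submodule.span_le.2 (fun F hF => ?_) hF'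
  obtain ⟨k, hk, f, hf⟩ := hcl hF
  exact h k hk f F hf

end SplitExtension

/-! ### The Wold decomposition of the shift -/

section Wold

theorem shift_basisVec (v : Vertex) :
    shift (basisVec v) = basisVec (v ++ [false]) + basisVec (v ++ [true]) := by
  ext w
  rw [shift_apply, lp.coeFn_add, Pi.add_apply, basisVec_apply, basisVec_apply, basisVec_apply]
  rcases List.eq_nil_or_concat' w with rfl | ⟨u, b, rfl⟩
  · simp
  · cases b <;> simp

/-- The adjoint of the shift sums over the children of a vertex. -/
theorem star_shift_apply (ξ : ℓ²(Vertex, ℂ)) (v : Vertex) :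
    star shift ξ v = ξ (v ++ [false]) + ξ (v ++ [true]) := by
  rw [← inner_basisVec, ContinuousLinearMap.star_eq_adjoint,
    ContinuousLinearMap.adjoint_inner_right, shift_basisVec, inner_add_left, inner_basisVec,
    inner_basisVec]

/-- The scalar `1 / √2`. -/
def invSqrtTwo : ℂ := ((Real.sqrt 2)⁻¹ : ℝ)

theorem star_invSqrtTwo : star invSqrtTwo = invSqrtTwo := Complex.conj_ofReal _

theorem invSqrtTwo_mul_self : invSqrtTwo * invSqrtTwo = 1 / 2 := by
  rw [invSqrtTwo, ← Complex.ofReal_mul, ← mul_inv, Real.mul_self_sqrt (by norm_num)]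
  norm_num

theorem invSqrtTwo_ne_zero : invSqrtTwo ≠ 0 := by
  intro h
  have := invSqrtTwo_mul_self
  rw [h] at this
  norm_num at this

/-- The isometry `S / √2`. -/
def isoShift : ℓ²(Vertex, ℂ) →L[ℂ] ℓ²(Vertex, ℂ) := invSqrtTwo • shift

theorem isoShift_apply (ξ : ℓ²(Vertex, ℂ)) (v : Vertex) :
    isoShift ξ v = invSqrtTwo * if v = [] then 0 else ξ v.dropLast := rfl

theorem star_isoShift_apply (ξ : ℓ²(Vertex, ℂ)) (v : Vertex) :
    star isoShift ξ v = invSqrtTwo * (ξ (v ++ [false]) + ξ (v ++ [true])) := by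
  rw [isoShift, star_smul, star_invSqrtTwo, _root_.smul_apply, lp.coeFn_smul, Pi.smul_apply,
    star_shift_apply, smul_eq_mul]

theorem star_isoShift_mul_self : star isoShift * isoShift = 1 := by
  ext ξ v
  rw [mul_apply_eq_comp, star_isoShift_apply, isoShift_apply, isoShift_apply]
  simp only [List.append_eq_nil_iff, List.cons_ne_nil, and_false, if_false,
    List.dropLast_concat, one_apply_eq_self]
  linear_combination (2 * ξ v) * invSqrtTwo_mul_self

/-- The orthonormal basis of the kernel of the adjoint shift that consists of the vector at the
root and of the normalised differences of the two children of each vertex. -/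
def kernelVec : Option Vertex → ℓ²(Vertex, ℂ)
  | none => basisVec []
  | some u => invSqrtTwo • (basisVec (u ++ [false]) - basisVec (u ++ [true]))

theorem kernelVec_none_apply (v : Vertex) : kernelVec none v = if v = [] then 1 else 0 :=
  basisVec_apply _ _

theorem kernelVec_some_apply (u v : Vertex) : kernelVec (some u) v =
    invSqrtTwo * ((if v = u ++ [false] then 1 else 0) - if v = u ++ [true] then 1 else 0) := by
  rw [kernelVec, lp.coeFn_smul, Pi.smul_apply, lp.coeFn_sub, Pi.sub_apply, basisVec_apply,
    basisVec_apply, smul_eq_mul]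

theorem inner_kernelVec_none (ξ : ℓ²(Vertex, ℂ)) : inner ℂ (kernelVec none) ξ = ξ [] :=
  inner_basisVec _ _

theorem inner_kernelVec_some (u : Vertex) (ξ : ℓ²(Vertex, ℂ)) :
    inner ℂ (kernelVec (some u)) ξ = invSqrtTwo * (ξ (u ++ [false]) - ξ (u ++ [true])) := by
  rw [kernelVec, inner_smul_left, inner_sub_left, inner_basisVec, inner_basisVec]
  congr 1
  exact star_invSqrtTwo

theorem inner_kernelVec (i j : Option Vertex) :
    inner ℂ (kernelVec i) (kernelVec j) = if i = j then 1 else 0 := by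
  cases i with
  | none =>
    rw [inner_kernelVec_none]
    cases j with
    | none => simp [kernelVec_none_apply]
    | some u => simp [kernelVec_some_apply]
  | some u =>
    rw [inner_kernelVec_some]
    cases j with
    | none => simp [kernelVec_none_apply]
    | some w =>
      simp only [kernelVec_some_apply, Option.some.injEq, List.append_cancel_right_eq]
      by_cases h : u = w
      · subst h
        simp only [List.append_cancel_left_eq, List.cons.injEq, and_true, if_true, if_false,
          Bool.false_eq_true, Bool.true_eq_false]
        linear_combination 2 * invSqrtTwo_mul_self
      · have h2 : ∀ b c : Bool, u ++ [b] ≠ w ++ [c] := fun b c e => h (List.append_inj' e rfl).1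
        simp [h, h2]

theorem star_isoShift_kernelVec (i : Option Vertex) : star isoShift (kernelVec i) = 0 := by
  ext v
  rw [star_isoShift_apply]
  cases i with
  | none => simp [kernelVec_none_apply]
  | some u =>
    simp only [kernelVec_some_apply]
    by_cases h : v = u
    · simp [h]
    · have h2 : ∀ b c : Bool, v ++ [b] ≠ u ++ [c] := fun b c e => h (List.append_inj' e rfl).1
      simp [h2]

theorem inner_isoShift (ξ η : ℓ²(Vertex, ℂ)) :
    inner ℂ (isoShift ξ) (isoShift η) = inner ℂ ξ η := by
  rw [← ContinuousLinearMap.adjoint_inner_right, ← ContinuousLinearMap.star_eq_adjoint,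
    ← mul_apply_eq_comp, star_isoShift_mul_self, one_apply_eq_self]

theorem inner_kernelVec_isoShift (i : Option Vertex) (η : ℓ²(Vertex, ℂ)) :
    inner ℂ (kernelVec i) (isoShift η) = 0 := by
  rw [← ContinuousLinearMap.adjoint_inner_left, ← ContinuousLinearMap.star_eq_adjoint,
    star_isoShift_kernelVec, inner_zero_left]

/-- The images of the kernel vectors under the powers of the isometry `S / √2`. -/
def woldVec (i : Option Vertex) (n : ℕ) : ℓ²(Vertex, ℂ) := (isoShift ^ n) (kernelVec i)

theorem woldVec_succ (i : Option Vertex) (n : ℕ) : woldVec i (n + 1) = isoShift (woldVec i n) := by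
  rw [woldVec, pow_succ', mul_apply_eq_comp, woldVec]

theorem woldVec_zero (i : Option Vertex) : woldVec i 0 = kernelVec i := rfl

theorem inner_woldVec (i j : Option Vertex) (m n : ℕ) :
    inner ℂ (woldVec i m) (woldVec j n) = if i = j ∧ m = n then 1 else 0 := by
  induction m generalizing n with
  | zero =>
    cases n with
    | zero => simp [woldVec_zero, inner_kernelVec]
    | succ n => simp [woldVec_zero, woldVec_succ, inner_kernelVec_isoShift]
  | succ m ih =>
    cases n with
    | zero =>
      rw [woldVec_zero, woldVec_succ, ← inner_conj_symm, inner_kernelVec_isoShift]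
      simp
    | succ n => rw [woldVec_succ, woldVec_succ, inner_isoShift, ih]; simp

theorem orthonormal_woldVec (i : Option Vertex) : Orthonormal ℂ (woldVec i) := by
  rw [orthonormal_iff_ite]
  intro m n
  rw [inner_woldVec]
  simp

/-- The isometry of `ℓ²(ℕ)` into `ℓ²(T)` onto the shift-invariant subspace that a kernel vector
generates. It intertwines the unilateral shift with `S / √2`. -/
def woldIso (i : Option Vertex) : ℓ²(ℕ, ℂ) →ₗᵢ[ℂ] ℓ²(Vertex, ℂ) :=
  (orthonormal_woldVec i).orthogonalFamily.linearIsometry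

theorem woldIso_basisVec (i : Option Vertex) (n : ℕ) : woldIso i (basisVec n) = woldVec i n := by
  rw [woldIso, basisVec, OrthogonalFamily.linearIsometry_apply_single]
  simp

theorem adjoint_woldIso_apply (i : Option Vertex) (η : ℓ²(Vertex, ℂ)) (n : ℕ) :
    (woldIso i).toContinuousLinearMap.adjoint η n = inner ℂ (woldVec i n) η := by
  rw [← inner_basisVec, ContinuousLinearMap.adjoint_inner_right, ← woldIso_basisVec]
  rfl

theorem orthogonalFamily_woldIso :
    OrthogonalFamily ℂ (fun _ : Option Vertex => ℓ²(ℕ, ℂ)) woldIso := by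
  intro i j hij ξ η
  have h : (woldIso i).toContinuousLinearMap.adjoint ∘L (woldIso j).toContinuousLinearMap = 0 := by
    refine lp.ext_continuousLinearMap (by simp) fun n => ?_
    ext m
    have h1 := adjoint_woldIso_apply i (woldIso j (basisVec n)) m
    rw [woldIso_basisVec, inner_woldVec, if_neg (fun e => hij e.1), ← woldIso_basisVec] at h1
    exact h1
  have h2 := congrArg (fun T => inner ℂ ξ (T η)) h
  simpa [ContinuousLinearMap.adjoint_inner_right] using h2

end Wold

/-! ### The boundary of the tree -/

section Boundary

/-- The inclusion of the boundary `K` in the compactification. -/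
def boundaryInclusion : C(Boundary, Compactification) where
  toFun x := ⟨fun n => some (x n), fun n h => by simp at h⟩
  continuous_toFun := by
    refine Continuous.subtype_mk (continuous_pi fun n => ?_) _
    exact continuous_of_discreteTopology.comp (continuous_apply n)

/-- The retraction of the compactification onto the boundary that continues a finite word by the
letter `false`. -/
def boundaryRetraction : C(Compactification, Boundary) where
  toFun s n := (s.1 n).getD false
  continuous_toFun := by
    refine continuous_pi fun n => ?_
    exact (continuous_of_discreteTopology (f := fun o : Option Bool => o.getD false)).comp
      ((continuous_apply n).comp continuous_subtype_val)

/-- Continuous functions on the compactification are uniformly continuous: their values at two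
words are close if the words agree in a sufficiently long initial piece. -/
theorem exists_norm_sub_lt (f : C(Compactification, ℂ)) {ε : ℝ} (hε : 0 < ε) :
    ∃ N, ∀ s t : Compactification, (∀ n < N, s.1 n = t.1 n) → ‖f s - f t‖ < ε := by
  by_contra! hcon
  let c : ℕ → Set (Compactification × Compactification) := fun N =>
    {p | (∀ n < N, p.1.1 n = p.2.1 n) ∧ ε ≤ ‖f p.1 - f p.2‖}
  have hcl : ∀ N, IsClosed (c N) := fun N => by
    have hf : Continuous fun p : Compactification × Compactification => ‖f p.1 - f p.2‖ :=
      ((f.continuous.comp continuous_fst).sub (f.continuous.comp continuous_snd)).norm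
    refine IsClosed.inter ?_ (isClosed_le continuous_const hf)
    change IsClosed {p : Compactification × Compactification | ∀ n < N, p.1.1 n = p.2.1 n}
    simp only [Set.ofPred_forall]
    refine isClosed_iInter fun n => isClosed_iInter fun _ => isClosed_eq ?_ ?_
    · exact (continuous_apply n).comp (continuous_subtype_val.comp continuous_fst)
    · exact (continuous_apply n).comp (continuous_subtype_val.comp continuous_snd)
  obtain ⟨⟨s, t⟩, hst⟩ := IsCompact.nonempty_iInter_of_sequence_nonempty_isCompact_isClosed c
    (fun N p hp => ⟨fun n hn => hp.1 n (by omega), hp.2⟩)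
    (fun N => by
      obtain ⟨s, t, h1, h2⟩ := hcon N
      exact ⟨(s, t), h1, h2⟩) (hcl 0).isCompact hcl
  rw [Set.mem_iInter] at hst
  have e : s = t := Subtype.ext (funext fun n => (hst (n + 1)).1 n (by omega))
  have h2 : ε ≤ ‖f s - f t‖ := (hst 0).2
  rw [e, sub_self, norm_zero] at h2
  exact absurd hε (not_lt.2 h2)

/-- If the words `p v` and `q v` agree in the first `|v| - 1` letters, then the difference of the
values of a continuous function at these words vanishes at infinity. -/
theorem tendsto_norm_sub {p q : Vertex → Compactification}
    (h : ∀ v : Vertex, ∀ n, n + 1 < v.length → (p v).1 n = (q v).1 n)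
    (f : C(Compactification, ℂ)) : Tendsto (fun v => ‖f (p v) - f (q v)‖) cofinite (𝓝 0) := by
  rw [Metric.tendsto_nhds]
  intro ε hε
  obtain ⟨N, hN⟩ := exists_norm_sub_lt f hε
  rw [eventually_cofinite]
  refine (List.finite_length_le Bool N).subset fun v hv => ?_
  by_contra hlen
  refine hv ?_
  rw [dist_zero_right, norm_norm]
  exact hN _ _ fun n hn => h v n (by
    simp only [Set.mem_ofPred_eq, not_le] at hlen
    omega)

theorem ofVertex_apply (v : Vertex) (n : ℕ) : (ofVertex v).1 n = v[n]? := rfl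

/-- The point of the boundary at which a continuous function is sampled on the summand of `ℓ²(T)`
with the given index: the word of the vertex, continued by the letter `false`. -/
def samplePoint : Option Vertex → Boundary
  | none => boundaryRetraction (ofVertex [])
  | some u => boundaryRetraction (ofVertex u)

theorem tendsto_option {f : Option Vertex → ℝ} (h : Tendsto (fun u => f (some u)) cofinite (𝓝 0)) :
    Tendsto f cofinite (𝓝 0) := by
  intro s hs
  rw [mem_map, mem_cofinite]
  have h1 := h hs
  rw [mem_map, mem_cofinite] at h1
  refine ((h1.image some).union (Set.finite_singleton none)).subset ?_
  rintro (_ | u) hu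
  · simp
  · exact Or.inl ⟨u, hu, rfl⟩

end Boundary

/-! ### The model operators -/

section ModelHomomorphism

/-- The algebra of continuous functions on the boundary with values in the operators on `ℓ²(ℕ)`. -/
abbrev BoundaryFun : Type := C(Boundary, ℓ²(ℕ, ℂ) →L[ℂ] ℓ²(ℕ, ℂ))

/-- The values of an operator-valued function at the sample points, as a `*`-homomorphism into the
bounded families of operators. -/
def sampleHom : BoundaryFun →⋆ₙₐ[ℂ]
    lp (fun _ : Option Vertex => ℓ²(ℕ, ℂ) →L[ℂ] ℓ²(ℕ, ℂ)) ⊤ where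
  toFun F := ⟨fun i => F (samplePoint i), memℓp_infty ⟨‖F‖, by
    rintro _ ⟨i, rfl⟩
    exact F.norm_coe_le_norm _⟩⟩
  map_smul' _ _ := rfl
  map_zero' := rfl
  map_add' _ _ := rfl
  map_mul' _ _ := rfl
  map_star' _ := rfl

theorem sampleHom_apply (F : BoundaryFun) (i : Option Vertex) :
    sampleHom F i = F (samplePoint i) := rfl

/-- The operator on `ℓ²(T)` that acts, in the Wold decomposition, on each summand `ℓ²(ℕ)` by the
value of `F` at the sample point of the summand. -/
def modelHom : BoundaryFun →⋆ₙₐ[ℂ] (ℓ²(Vertex, ℂ) →L[ℂ] ℓ²(Vertex, ℂ)) :=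
  (blockHom orthogonalFamily_woldIso).comp sampleHom

theorem modelHom_apply (F : BoundaryFun) :
    modelHom F = blockOp orthogonalFamily_woldIso (sampleHom F) := rfl

theorem modelHom_apply_congr {F G : BoundaryFun} {ξ η : ℓ²(Vertex, ℂ)}
    (h : ∀ i, F (samplePoint i) ((woldIso i).toContinuousLinearMap.adjoint ξ) =
      G (samplePoint i) ((woldIso i).toContinuousLinearMap.adjoint η)) :
    modelHom F ξ = modelHom G η :=
  blockOp_apply_congr _ h

theorem norm_modelHom_le (F : BoundaryFun) : ‖modelHom F‖ ≤ ‖F‖ :=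
  (norm_blockOp_le _ _).trans (lp.norm_le_of_forall_le (norm_nonneg F)
    fun _ => F.norm_coe_le_norm _)

/-- The initial pieces of an infinite path. -/
def initialPiece (x : Boundary) (n : ℕ) : Vertex := (List.range n).map x

theorem tendsto_samplePoint_initialPiece (x : Boundary) :
    Tendsto (fun n => samplePoint (some (initialPiece x n))) atTop (𝓝 x) := by
  rw [tendsto_pi_nhds]
  intro m
  refine tendsto_const_nhds.congr' ?_
  filter_upwards [eventually_gt_atTop m] with n hn
  simp [samplePoint, boundaryRetraction, ofVertex, initialPiece, hn]

theorem tendsto_initialPiece_cofinite (x : Boundary) :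
    Tendsto (fun n => some (initialPiece x n)) atTop cofinite := by
  rw [← Nat.cofinite_eq_atTop]
  refine Function.Injective.tendsto_cofinite fun m n h => ?_
  have := congrArg List.length (Option.some.inj h)
  simpa [initialPiece] using this

/-- The model operator of `F` determines `F` modulo compact operators: along the initial pieces
`u` of a path `x`, the compressions of a compact operator to the summands of the vertices `u` tend
to zero, and those of the model operator are values of `F` at points that tend to `x`. -/
theorem norm_le_norm_modelHom_add (F : BoundaryFun) {k : ℓ²(Vertex, ℂ) →L[ℂ] ℓ²(Vertex, ℂ)}
    (hk : k ∈ compacts ℓ²(Vertex, ℂ)) : ‖F‖ ≤ ‖modelHom F + k‖ := by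
  rw [ContinuousMap.norm_le _ (norm_nonneg _)]
  intro x
  let W : Option Vertex → ℓ²(ℕ, ℂ) →L[ℂ] ℓ²(Vertex, ℂ) := fun i =>
    (woldIso i).toContinuousLinearMap
  have hW : ∀ i, ‖W i‖ ≤ 1 := fun i => (woldIso i).norm_toContinuousLinearMap_le
  have hWa : ∀ i, ‖(W i).adjoint‖ ≤ 1 := fun i => by
    rw [LinearIsometryEquiv.norm_map]
    exact hW i
  have hk0 := (tendsto_norm_comp_compact (B := fun i => (W i).adjoint) hWa
    (fun η => tendsto_adjoint_apply orthogonalFamily_woldIso η) hk).comp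
      (tendsto_initialPiece_cofinite x)
  have hF := ((F.continuous.tendsto x).comp (tendsto_samplePoint_initialPiece x)).norm
  have hlim := tendsto_const_nhds (x := ‖modelHom F + k‖) (f := (atTop : Filter ℕ)) |>.add hk0
  rw [add_zero] at hlim
  refine le_of_tendsto_of_tendsto' hF hlim fun n => ?_
  set i := some (initialPiece x n) with hi
  have e : F (samplePoint i) = (W i).adjoint ∘L (modelHom F + k) ∘L W i -
      ((W i).adjoint ∘L k) ∘L W i := by
    ext1 ξ
    have h1 : modelHom F (W i ξ) = W i (F (samplePoint i) ξ) :=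
      blockOp_apply_apply orthogonalFamily_woldIso (sampleHom F) i ξ
    have h2 : ∀ η, (W i).adjoint (W i η) = η := fun η => by
      refine ext_inner_left ℂ fun ζ => ?_
      rw [ContinuousLinearMap.adjoint_inner_right]
      exact (woldIso i).inner_map_map ζ η
    simp [h1, h2]
  change ‖F (samplePoint i)‖ ≤ ‖modelHom F + k‖ + ‖(W i).adjoint ∘L k‖
  rw [e]
  refine (norm_sub_le _ _).trans (add_le_add ?_ ?_)
  · calc _ ≤ 1 * (‖modelHom F + k‖ * 1) :=
        (ContinuousLinearMap.opNorm_comp_le _ _).trans (mul_le_mul (hWa i)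
          ((ContinuousLinearMap.opNorm_comp_le _ _).trans
            (mul_le_mul_of_nonneg_left (hW i) (norm_nonneg _))) (norm_nonneg _) zero_le_one)
      _ = _ := by ring
  · calc _ ≤ ‖(W i).adjoint ∘L k‖ * 1 := (ContinuousLinearMap.opNorm_comp_le _ _).trans
          (mul_le_mul_of_nonneg_left (hW i) (norm_nonneg _))
      _ = _ := mul_one _

theorem eq_zero_of_modelHom_mem_compacts {F : BoundaryFun}
    (h : modelHom F ∈ compacts ℓ²(Vertex, ℂ)) : F = 0 := by
  have := norm_le_norm_modelHom_add F (neg_mem h)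
  rw [add_neg_cancel, norm_zero] at this
  exact (norm_le_zero_iff (a := F)).1 this

/-- The elementary tensor `k ⊗ f`, as an operator-valued function. -/
def elemTensor (k : ℓ²(ℕ, ℂ) →L[ℂ] ℓ²(ℕ, ℂ)) (f : C(Boundary, ℂ)) : BoundaryFun where
  toFun x := f x • k
  continuous_toFun := by fun_prop

theorem elemTensor_apply (k : ℓ²(ℕ, ℂ) →L[ℂ] ℓ²(ℕ, ℂ)) (f : C(Boundary, ℂ)) (x : Boundary) :
    elemTensor k f x = f x • k := rfl

theorem star_elemTensor (k : ℓ²(ℕ, ℂ) →L[ℂ] ℓ²(ℕ, ℂ)) (f : C(Boundary, ℂ)) :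
    star (elemTensor k f) = elemTensor (star k) (star f) := by
  ext1 x
  simp only [ContinuousMap.star_apply, elemTensor_apply, star_smul]

/-- The model operator of the function `f` times the matrix unit at `(m, n)`. -/
def modelUnit (m n : ℕ) (f : C(Boundary, ℂ)) : ℓ²(Vertex, ℂ) →L[ℂ] ℓ²(Vertex, ℂ) :=
  modelHom (elemTensor (matrixUnit m n) f)

theorem star_modelUnit (m n : ℕ) (f : C(Boundary, ℂ)) :
    star (modelUnit m n f) = modelUnit n m (star f) := by
  rw [modelUnit, ← map_star, star_elemTensor, star_matrixUnit, modelUnit]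

theorem modelUnit_mul_modelUnit (m n l : ℕ) (f g : C(Boundary, ℂ)) :
    modelUnit m n f * modelUnit n l g = modelUnit m l (f * g) := by
  rw [modelUnit, modelUnit, ← map_mul, modelUnit]
  congr 1
  ext1 x
  rw [ContinuousMap.mul_apply, elemTensor_apply, elemTensor_apply, elemTensor_apply,
    smul_mul_smul_comm, matrixUnit_mul, ContinuousMap.mul_apply]

theorem modelUnit_mul_star_isoShift (m n : ℕ) (f : C(Boundary, ℂ)) :
    modelUnit m n f * star isoShift = modelUnit m (n + 1) f := by
  ext1 ξ
  rw [mul_apply_eq_comp]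
  refine modelHom_apply_congr fun i => ?_
  rw [elemTensor_apply, elemTensor_apply, _root_.smul_apply,
    _root_.smul_apply, matrixUnit_apply, matrixUnit_apply, adjoint_woldIso_apply,
    adjoint_woldIso_apply, woldVec_succ, ContinuousLinearMap.star_eq_adjoint,
    ContinuousLinearMap.adjoint_inner_right]

theorem modelUnit_zero_mul_isoShift (m : ℕ) (f : C(Boundary, ℂ)) :
    modelUnit m 0 f * isoShift = 0 := by
  ext1 ξ
  rw [mul_apply_eq_comp, _root_.zero_apply, ← map_zero (modelUnit m 0 f)]
  refine modelHom_apply_congr fun i => ?_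
  rw [elemTensor_apply, _root_.smul_apply,
    _root_.smul_apply, matrixUnit_apply, matrixUnit_apply, adjoint_woldIso_apply,
    adjoint_woldIso_apply, woldVec_zero, inner_kernelVec_isoShift, inner_zero_right]

theorem isoShift_mul_modelUnit (m n : ℕ) (f : C(Boundary, ℂ)) :
    isoShift * modelUnit m n f = modelUnit (m + 1) n f := by
  have := congrArg star (modelUnit_mul_star_isoShift n m (star f))
  simpa [star_mul, star_modelUnit] using this

theorem star_isoShift_mul_modelUnit_zero (n : ℕ) (f : C(Boundary, ℂ)) :
    star isoShift * modelUnit 0 n f = 0 := by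
  have := congrArg star (modelUnit_zero_mul_isoShift n (star f))
  simpa [star_mul, star_modelUnit] using this

theorem star_isoShift_mul_modelUnit_succ (m n : ℕ) (f : C(Boundary, ℂ)) :
    star isoShift * modelUnit (m + 1) n f = modelUnit m n f := by
  rw [← isoShift_mul_modelUnit, ← mul_assoc, star_isoShift_mul_self, one_mul]

theorem modelUnit_eq (m n : ℕ) (f : C(Boundary, ℂ)) :
    modelUnit m n f = isoShift ^ m * modelUnit 0 0 f * star isoShift ^ n := by
  have h1 : isoShift ^ m * modelUnit 0 0 f = modelUnit m 0 f := by
    induction m with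
    | zero => rw [pow_zero, one_mul]
    | succ m ih => rw [pow_succ', mul_assoc, ih, isoShift_mul_modelUnit]
  rw [h1]
  induction n with
  | zero => rw [pow_zero, mul_one]
  | succ n ih => rw [pow_succ, ← mul_assoc, ← ih, modelUnit_mul_star_isoShift]

/-- The projection onto the kernel of the adjoint shift. -/
theorem one_sub_isoShift_mul_star : 1 - isoShift * star isoShift = modelUnit 0 0 1 := by
  have h0 : ∀ η : ℓ²(Vertex, ℂ), (∀ i, inner ℂ (kernelVec i) η = 0) →
      isoShift (star isoShift η) = η := by
    intro η hη
    ext v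
    rw [isoShift_apply, star_isoShift_apply]
    rcases List.eq_nil_or_concat' v with rfl | ⟨u, b, rfl⟩
    · have := hη none
      rw [inner_kernelVec_none] at this
      simp [this]
    · have := hη (some u)
      rw [inner_kernelVec_some, mul_eq_zero, or_iff_right invSqrtTwo_ne_zero, sub_eq_zero] at this
      simp only [List.append_eq_nil_iff, List.cons_ne_nil, and_false, if_false,
        List.dropLast_concat]
      cases b
      · linear_combination
          (η (u ++ [false]) + η (u ++ [true])) * invSqrtTwo_mul_self - this / 2
      · linear_combination
          (η (u ++ [false]) + η (u ++ [true])) * invSqrtTwo_mul_self + this / 2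
  have hP : ∀ i ξ, inner ℂ (kernelVec i) (modelUnit 0 0 1 ξ) = inner ℂ (kernelVec i) ξ := by
    intro i ξ
    have h1 : modelUnit 0 0 1 (kernelVec i) = kernelVec i := by
      have h2 := blockOp_apply_apply orthogonalFamily_woldIso
        (sampleHom (elemTensor (matrixUnit 0 0) 1)) i (basisVec 0)
      rw [← modelHom_apply, woldIso_basisVec, woldVec_zero, sampleHom_apply, elemTensor_apply,
        ContinuousMap.one_apply, one_smul, matrixUnit_apply, basisVec_apply, if_pos rfl, one_smul,
        woldIso_basisVec, woldVec_zero] at h2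
      exact h2
    have h3 : (modelUnit 0 0 1).adjoint = modelUnit 0 0 1 := by
      rw [← ContinuousLinearMap.star_eq_adjoint, star_modelUnit, star_one]
    rw [← ContinuousLinearMap.adjoint_inner_left, h3, h1]
  ext1 ξ
  have h1 := h0 (ξ - modelUnit 0 0 1 ξ) (fun i => by rw [inner_sub_right, hP, sub_self])
  have h2 : star isoShift (modelUnit 0 0 1 ξ) = 0 :=
    congrArg (fun T => T ξ) (star_isoShift_mul_modelUnit_zero 0 1)
  rw [map_sub, h2, sub_zero] at h1
  rw [_root_.sub_apply, one_apply_eq_self, mul_apply_eq_comp, h1]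
  abel

end ModelHomomorphism

/-! ### Multiplication operators modulo compact operators -/

section Multiplication

theorem star_mulOp (f : C(Compactification, ℂ)) : star (mulOp f) = mulOp (star f) := by
  rw [ContinuousLinearMap.star_eq_adjoint, eq_comm, ContinuousLinearMap.eq_adjoint_iff]
  intro ξ η
  rw [lp.inner_eq_tsum, lp.inner_eq_tsum]
  refine tsum_congr fun v => ?_
  simp only [mulOp_apply, ContinuousMap.star_apply, RCLike.inner_apply, map_mul]
  rw [starRingEnd_apply, star_star]
  ring

theorem mulOp_mul_comm (f g : C(Compactification, ℂ)) : mulOp f * mulOp g = mulOp g * mulOp f := by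
  ext ξ v
  simp only [mul_apply_eq_comp, mulOp_apply]
  ring

/-- Multiplication operators commute with the shift modulo compact operators. -/
theorem shift_mulOp_commutator_mem (f : C(Compactification, ℂ)) :
    shift * mulOp f - mulOp f * shift ∈ compacts ℓ²(Vertex, ℂ) := by
  -- The commutator is the product of the diagonal operator with entries `f (par v) - f v`
  -- and the shift.
  let c : Vertex → ℂ := fun v => f (ofVertex v.dropLast) - f (ofVertex v)
  have hc : Tendsto (fun v => ‖c v‖) cofinite (𝓝 0) := tendsto_norm_sub (fun v n hn => by
    rw [ofVertex_apply, ofVertex_apply, List.getElem?_dropLast, if_pos (by omega)]) f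
  have hd : ∀ v, ‖c v • ContinuousLinearMap.id ℂ ℂ‖ = ‖c v‖ := fun v => by
    rw [norm_smul, ContinuousLinearMap.norm_id, mul_one]
  have hd0 : Tendsto (fun v => ‖c v • ContinuousLinearMap.id ℂ ℂ‖) cofinite (𝓝 0) := by
    simpa only [hd] using hc
  let F : lp (fun _ : Vertex => ℂ →L[ℂ] ℂ) ⊤ :=
    ⟨fun v => c v • ContinuousLinearMap.id ℂ ℂ, memℓp_infty hd0.bddAbove_range_of_cofinite⟩
  have hF : IsCompactOperator (blockDiag F) :=
    isCompactOperator_blockDiag (fun v => isCompactOperator_of_locallyCompactSpace_dom (F v)) hd0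
  have e : shift * mulOp f - mulOp f * shift = blockDiag F * shift := by
    ext ξ v
    have h1 : (blockDiag F * shift) ξ v = c v * shift ξ v := rfl
    rw [h1, _root_.sub_apply, lp.coeFn_sub, Pi.sub_apply, mul_apply_eq_comp, mul_apply_eq_comp,
      mulOp_apply, shift_apply, shift_apply, mulOp_apply]
    split_ifs
    · ring
    · ring
  rw [e]
  exact mem_compacts_mul (mem_compacts.2 hF) _

theorem isoShift_mulOp_commutator_mem (f : C(Compactification, ℂ)) :
    isoShift * mulOp f - mulOp f * isoShift ∈ compacts ℓ²(Vertex, ℂ) := by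
  rw [isoShift, smul_mul_assoc, mul_smul_comm, ← smul_sub]
  exact SMulMemClass.smul_mem _ (shift_mulOp_commutator_mem f)

theorem star_isoShift_mulOp_commutator_mem (f : C(Compactification, ℂ)) :
    star isoShift * mulOp f - mulOp f * star isoShift ∈ compacts ℓ²(Vertex, ℂ) := by
  have := neg_mem (star_mem (isoShift_mulOp_commutator_mem (star f)))
  simpa [star_mulOp] using this

/-- The diagonal entries of a multiplication operator at the kernel vectors. -/
def kernelMean (f : C(Compactification, ℂ)) : Option Vertex → ℂ
  | none => f (ofVertex [])
  | some u => (f (ofVertex (u ++ [false])) + f (ofVertex (u ++ [true]))) / 2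

/-- The compression of a multiplication operator to the kernel of the adjoint shift is diagonal in
the basis of the kernel vectors, as distinct kernel vectors have disjoint supports. -/
theorem modelUnit_mulOp_kernelVec (f : C(Compactification, ℂ)) (i : Option Vertex) :
    modelUnit 0 0 1 (mulOp f (kernelVec i)) = kernelMean f i • kernelVec i := by
  rw [← one_sub_isoShift_mul_star]
  ext v
  rw [_root_.sub_apply, one_apply_eq_self, mul_apply_eq_comp, lp.coeFn_sub, Pi.sub_apply,
    isoShift_apply, star_isoShift_apply, lp.coeFn_smul, Pi.smul_apply, smul_eq_mul]
  simp only [mulOp_apply]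
  cases i with
  | none =>
    by_cases h : v = []
    · subst h
      simp [kernelVec_none_apply, kernelMean]
    · simp [kernelVec_none_apply, h]
  | some u =>
    rcases List.eq_nil_or_concat' v with rfl | ⟨w, b, rfl⟩
    · simp [kernelVec_some_apply]
    · simp only [kernelVec_some_apply, kernelMean, List.append_eq_nil_iff, List.cons_ne_nil,
        and_false, if_false, List.dropLast_concat]
      by_cases h : w = u
      · subst h
        cases b <;> simp only [List.append_cancel_left_eq, List.cons.injEq, and_true, if_true,
          if_false, Bool.false_eq_true, Bool.true_eq_false]
        · linear_combination (-invSqrtTwo * (f (ofVertex (w ++ [false])) -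
            f (ofVertex (w ++ [true])))) * invSqrtTwo_mul_self
        · linear_combination (-invSqrtTwo * (f (ofVertex (w ++ [false])) -
            f (ofVertex (w ++ [true])))) * invSqrtTwo_mul_self
      · have h2 : ∀ b c : Bool, w ++ [b] ≠ u ++ [c] := fun b c e => h (List.append_inj' e rfl).1
        simp [h2]

theorem tendsto_kernelMean_sub (f : C(Compactification, ℂ)) :
    Tendsto (fun i => ‖kernelMean f i - f (boundaryInclusion (samplePoint i))‖) cofinite (𝓝 0) := by
  refine tendsto_option ?_
  have h : ∀ b : Bool, Tendsto (fun u : Vertex => ‖f (ofVertex (u ++ [b])) -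
      f (boundaryInclusion (samplePoint (some u)))‖) cofinite (𝓝 0) := fun b =>
    tendsto_norm_sub (fun u n hn => by
      have hn' : n < u.length := by omega
      simp [ofVertex_apply, boundaryInclusion, samplePoint, boundaryRetraction, hn',
        List.getElem?_append_left]) f
  have h2 := ((h false).add (h true)).div_const 2
  rw [add_zero, zero_div] at h2
  refine squeeze_zero (fun _ => norm_nonneg _) (fun u => ?_) h2
  have e : kernelMean f (some u) - f (boundaryInclusion (samplePoint (some u))) =
      ((f (ofVertex (u ++ [false])) - f (boundaryInclusion (samplePoint (some u)))) +
        (f (ofVertex (u ++ [true])) - f (boundaryInclusion (samplePoint (some u))))) / 2 := by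
    rw [kernelMean]
    ring
  rw [e, norm_div]
  simp only [Complex.norm_ofNat]
  gcongr
  exact norm_add_le _ _

theorem mulOp_mul_modelUnit_zero_zero (f : C(Compactification, ℂ)) :
    mulOp f * modelUnit 0 0 1 - modelUnit 0 0 (f.comp boundaryInclusion) ∈
      compacts ℓ²(Vertex, ℂ) := by
  let c : Option Vertex → ℂ := fun i => kernelMean f i - f (boundaryInclusion (samplePoint i))
  have h0 : Tendsto (fun i => ‖c i • matrixUnit (0 : ℕ) 0‖) cofinite (𝓝 0) := by
    simp only [norm_smul]
    simpa using (tendsto_kernelMean_sub f).mul_const ‖matrixUnit (0 : ℕ) 0‖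
  let G : lp (fun _ : Option Vertex => ℓ²(ℕ, ℂ) →L[ℂ] ℓ²(ℕ, ℂ)) ⊤ :=
    ⟨fun i => c i • matrixUnit 0 0, memℓp_infty h0.bddAbove_range_of_cofinite⟩
  have hG : blockOp orthogonalFamily_woldIso G ∈ compacts ℓ²(Vertex, ℂ) :=
    isCompactOperator_blockOp _ (fun i =>
      SMulMemClass.smul_mem (s := compacts ℓ²(ℕ, ℂ)) (c i) (matrixUnit_mem_compacts 0 0)) h0
  -- The compression of the multiplication operator.
  have h1 : modelUnit 0 0 1 * (mulOp f * modelUnit 0 0 1) -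
      modelUnit 0 0 (f.comp boundaryInclusion) = blockOp orthogonalFamily_woldIso G := by
    rw [sub_eq_iff_eq_add, ← blockHom_apply]
    change _ = _ + blockHom orthogonalFamily_woldIso _
    rw [← map_add]
    ext1 ξ
    rw [mul_apply_eq_comp]
    refine blockOp_apply_congr orthogonalFamily_woldIso fun i => ?_
    change ((1 : C(Boundary, ℂ)) (samplePoint i) • matrixUnit 0 0) _ =
      (c i • matrixUnit 0 0 + f (boundaryInclusion (samplePoint i)) • matrixUnit 0 0 :
        ℓ²(ℕ, ℂ) →L[ℂ] ℓ²(ℕ, ℂ)) _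
    rw [ContinuousMap.one_apply, one_smul, ← add_smul, sub_add_cancel, _root_.smul_apply,
      matrixUnit_apply, matrixUnit_apply, smul_smul, adjoint_woldIso_apply, adjoint_woldIso_apply,
      woldVec_zero]
    congr 1
    have e : star (mulOp f * modelUnit 0 0 1) (kernelVec i) =
        kernelMean (star f) i • kernelVec i := by
      rw [star_mul, star_mulOp, star_modelUnit, star_one, mul_apply_eq_comp,
        modelUnit_mulOp_kernelVec]
    rw [← ContinuousLinearMap.adjoint_inner_left, ← ContinuousLinearMap.star_eq_adjoint, e,
      inner_smul_left]
    congr 1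
    cases i <;> simp [kernelMean, Complex.conj_ofNat]
  -- The projection commutes with the multiplication operator modulo compact operators.
  have h2 : mulOp f * modelUnit 0 0 1 - modelUnit 0 0 1 * mulOp f ∈ compacts ℓ²(Vertex, ℂ) := by
    have e : mulOp f * modelUnit 0 0 1 - modelUnit 0 0 1 * mulOp f =
        isoShift * (star isoShift * mulOp f - mulOp f * star isoShift) +
        (isoShift * mulOp f - mulOp f * isoShift) * star isoShift := by
      rw [← one_sub_isoShift_mul_star]
      noncomm_ring
    rw [e]
    exact add_mem (mul_mem_compacts _ (star_isoShift_mulOp_commutator_mem f))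
      (mem_compacts_mul (isoShift_mulOp_commutator_mem f) _)
  have h3 : modelUnit 0 0 1 * modelUnit 0 0 1 = modelUnit 0 0 1 := by
    rw [modelUnit_mul_modelUnit, one_mul]
  have e : mulOp f * modelUnit 0 0 1 - modelUnit 0 0 (f.comp boundaryInclusion) =
      (mulOp f * modelUnit 0 0 1 - modelUnit 0 0 1 * mulOp f) * modelUnit 0 0 1 +
        blockOp orthogonalFamily_woldIso G := by
    rw [← h1, sub_mul, mul_assoc, mul_assoc, h3]
    abel
  rw [e]
  exact add_mem (mem_compacts_mul h2 _) hG

/-- Modulo compact operators, multiplication by `f` acts on the model operators as multiplication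
by the restriction of `f` to the boundary. -/
theorem mulOp_mul_modelUnit (f : C(Compactification, ℂ)) (m n : ℕ) (g : C(Boundary, ℂ)) :
    mulOp f * modelUnit m n g - modelUnit m n (f.comp boundaryInclusion * g) ∈
      compacts ℓ²(Vertex, ℂ) := by
  induction m with
  | zero =>
    have h := mem_compacts_mul (mulOp_mul_modelUnit_zero_zero f) (modelUnit 0 n g)
    rwa [sub_mul, mul_assoc, modelUnit_mul_modelUnit, modelUnit_mul_modelUnit, one_mul] at h
  | succ m ih =>
    rw [← isoShift_mul_modelUnit, ← isoShift_mul_modelUnit]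
    have e : mulOp f * (isoShift * modelUnit m n g) -
        isoShift * modelUnit m n (f.comp boundaryInclusion * g) =
        isoShift * (mulOp f * modelUnit m n g - modelUnit m n (f.comp boundaryInclusion * g)) -
        (isoShift * mulOp f - mulOp f * isoShift) * modelUnit m n g := by
      noncomm_ring
    rw [e]
    exact sub_mem (mul_mem_compacts _ ih) (mem_compacts_mul (isoShift_mulOp_commutator_mem f) _)

end Multiplication

/-! ### The commutator ideal of the tree algebra -/

section CommutatorIdealTree

theorem shift_mem_treeAlgebra : shift ∈ treeAlgebra :=
  subset_closure (StarAlgebra.subset_adjoin ℂ _ (Or.inl rfl))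

theorem mulOp_mem_treeAlgebra (f : C(Compactification, ℂ)) : mulOp f ∈ treeAlgebra :=
  subset_closure (StarAlgebra.subset_adjoin ℂ _ (Or.inr ⟨f, rfl⟩))

theorem isoShift_mem_treeAlgebra : isoShift ∈ treeAlgebra :=
  SMulMemClass.smul_mem _ shift_mem_treeAlgebra

/-- The indicator function of a vertex. -/
def vertexIndicator (v : Vertex) : C(Compactification, ℂ) where
  toFun s := if ∀ n : Fin (v.length + 1), s.1 n = v[(n : ℕ)]? then 1 else 0
  continuous_toFun := by
    refine (continuous_of_discreteTopology (f := fun t : Fin (v.length + 1) → Option Bool =>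
      if ∀ n : Fin (v.length + 1), t n = v[(n : ℕ)]? then (1 : ℂ) else 0)).comp
      (f := fun s : Compactification => fun n : Fin (v.length + 1) => s.1 n) ?_
    exact continuous_pi fun n => (continuous_apply (n : ℕ)).comp continuous_subtype_val

theorem vertexIndicator_ofVertex (v w : Vertex) :
    vertexIndicator v (ofVertex w) = if w = v then 1 else 0 := by
  refine if_congr ⟨fun h => ?_, fun h n => by rw [h, ofVertex_apply]⟩ rfl rfl
  have hlen : w.length ≤ v.length := by
    have := h (Fin.last _)
    rwa [Fin.val_last, List.getElem?_eq_none le_rfl, ofVertex_apply,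
      List.getElem?_eq_none_iff] at this
  refine List.ext_getElem? fun n => ?_
  by_cases hn : n < v.length + 1
  · exact h ⟨n, hn⟩
  · rw [List.getElem?_eq_none (by omega), List.getElem?_eq_none (by omega)]

theorem mulOp_vertexIndicator (v : Vertex) : mulOp (vertexIndicator v) = matrixUnit v v := by
  ext ξ w
  rw [mulOp_apply, vertexIndicator_ofVertex, matrixUnit_apply, lp.coeFn_smul, Pi.smul_apply,
    basisVec_apply]
  split_ifs with h
  · simp [h]
  · simp

theorem matrixUnit_child_mem (v : Vertex) (b : Bool) :
    matrixUnit (v ++ [b]) v ∈ commutatorIdeal treeAlgebra := by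
  have hA : ∀ u : Vertex, matrixUnit u u ∈ treeAlgebra := fun u =>
    mulOp_vertexIndicator u ▸ mulOp_mem_treeAlgebra _
  have h := mem_commutatorIdeal_mul (mul_mem_commutatorIdeal (hA (v ++ [b]))
    (commutator_mem_commutatorIdeal shift_mem_treeAlgebra (hA v))) (hA v)
  convert! h using 1
  ext1 ξ
  have h1 : ∀ η : ℓ²(Vertex, ℂ), (shift * matrixUnit v v - matrixUnit v v * shift) η =
      η v • shift (basisVec v) - (shift η) v • basisVec v := fun η => by
    rw [_root_.sub_apply, mul_apply_eq_comp, mul_apply_eq_comp, matrixUnit_apply, matrixUnit_apply,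
      map_smul]
  rw [mul_apply_eq_comp, mul_apply_eq_comp, matrixUnit_apply, matrixUnit_apply, matrixUnit_apply,
    h1]
  congr 1
  have h2 : v.dropLast = v → v = [] := fun e => by
    have := congrArg List.length e
    rw [List.length_dropLast] at this
    exact List.length_eq_zero_iff.1 (by omega)
  have h3 : shift (ξ v • basisVec v) v = 0 := by
    rw [map_smul, lp.coeFn_smul, Pi.smul_apply, shift_apply, basisVec_apply]
    split_ifs with h4 h5
    · exact smul_zero _
    · exact absurd (h2 h5) h4
    · exact smul_zero _
  rw [h3, zero_smul, sub_zero]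
  simp [basisVec_apply]

theorem matrixUnit_mem_commutatorIdeal (v w : Vertex) :
    matrixUnit v w ∈ commutatorIdeal treeAlgebra := by
  have hroot : ∀ v : Vertex, matrixUnit v [] ∈ commutatorIdeal treeAlgebra := by
    intro v
    induction v using List.reverseRecOn with
    | nil =>
      have h := matrixUnit_child_mem [] false
      have h2 := mul_mem (star_mem h) h
      rwa [star_matrixUnit, matrixUnit_mul] at h2
    | append_singleton u b ih =>
      have h := mul_mem (matrixUnit_child_mem u b) ih
      rwa [matrixUnit_mul] at h
  have h := mul_mem (hroot v) (star_mem (hroot w))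
  rwa [star_matrixUnit, matrixUnit_mul] at h

theorem compacts_le_commutatorIdeal :
    compacts ℓ²(Vertex, ℂ) ≤ commutatorIdeal treeAlgebra := fun _ hT =>
  compact_mem_of_matrixUnit_mem (M := (commutatorIdeal treeAlgebra).toSubmodule)
    (isClosed_commutatorIdeal _) matrixUnit_mem_commutatorIdeal hT

theorem modelUnit_mem_commutatorIdeal (m n : ℕ) (f : C(Boundary, ℂ)) :
    modelUnit m n f ∈ commutatorIdeal treeAlgebra := by
  have hV := isoShift_mem_treeAlgebra
  have hP : modelUnit 0 0 1 ∈ commutatorIdeal treeAlgebra := by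
    have := commutator_mem_commutatorIdeal (star_mem hV) hV
    rwa [star_isoShift_mul_self, one_sub_isoShift_mul_star] at this
  have h0 : modelUnit 0 0 f ∈ commutatorIdeal treeAlgebra := by
    have h1 := mul_mem_commutatorIdeal (mulOp_mem_treeAlgebra (f.comp boundaryRetraction)) hP
    have h2 := compacts_le_commutatorIdeal
      (mulOp_mul_modelUnit_zero_zero (f.comp boundaryRetraction))
    have e : (f.comp boundaryRetraction).comp boundaryInclusion = f := rfl
    rw [e] at h2
    have := sub_mem h1 h2
    rwa [sub_sub_cancel] at this
  rw [modelUnit_eq]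
  exact mem_commutatorIdeal_mul (mul_mem_commutatorIdeal (pow_mem hV m) h0)
    (pow_mem (star_mem hV) n)

/-- The C*-tensor product of the compact operators on `ℓ²(ℕ)` with `C(K)`. -/
abbrev compactTensor : NonUnitalStarSubalgebra ℂ BoundaryFun :=
  tensorContinuous (compacts ℓ²(ℕ, ℂ)) Boundary

theorem elemTensor_mem {k : ℓ²(ℕ, ℂ) →L[ℂ] ℓ²(ℕ, ℂ)} (hk : k ∈ compacts ℓ²(ℕ, ℂ))
    (f : C(Boundary, ℂ)) : elemTensor k f ∈ compactTensor :=
  subset_closure (NonUnitalStarAlgebra.subset_adjoin ℂ _ ⟨k, hk, f, fun _ => rfl⟩)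

/-- The elementary tensors `k ⊗ f` with a fixed function `f`, as a continuous linear map. -/
def elemTensorCLM (f : C(Boundary, ℂ)) : (ℓ²(ℕ, ℂ) →L[ℂ] ℓ²(ℕ, ℂ)) →L[ℂ] BoundaryFun :=
  LinearMap.mkContinuous
    { toFun := fun k => elemTensor k f
      map_add' := fun k l => by
        ext1 x
        exact smul_add _ _ _
      map_smul' := fun c k => by
        ext1 x
        exact smul_comm _ _ _ } ‖f‖ (fun k => by
      refine (ContinuousMap.norm_le _ (by positivity)).2 fun x => ?_
      exact (norm_smul_le (f x) k).trans
        (mul_le_mul_of_nonneg_right (f.norm_coe_le_norm x) (norm_nonneg _)))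

/-- The tensors of matrix units with continuous functions span a dense subspace. -/
theorem mem_of_mem_compactTensor {M : Submodule ℂ BoundaryFun}
    (hM : IsClosed (M : Set BoundaryFun)) (h : ∀ m n f, elemTensor (matrixUnit m n) f ∈ M)
    {F : BoundaryFun} (hF : F ∈ compactTensor) : F ∈ M := by
  refine mem_of_mem_tensorContinuous hM (fun k hk f F hf => ?_) hF
  have e : F = elemTensorCLM f k := ContinuousMap.ext hf
  rw [e]
  exact compact_mem_of_matrixUnit_mem
    (M := M.comap (elemTensorCLM f : (ℓ²(ℕ, ℂ) →L[ℂ] ℓ²(ℕ, ℂ)) →ₗ[ℂ] BoundaryFun))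
    (hM.preimage (elemTensorCLM f).continuous) (fun m n => h m n f) hk

/-- The map `modelHom` as a continuous linear map. -/
def modelCLM : BoundaryFun →L[ℂ] ℓ²(Vertex, ℂ) →L[ℂ] ℓ²(Vertex, ℂ) :=
  contractionCLM modelHom norm_modelHom_le

theorem modelHom_mem_commutatorIdeal {F : BoundaryFun} (hF : F ∈ compactTensor) :
    modelHom F ∈ commutatorIdeal treeAlgebra :=
  mem_of_mem_compactTensor
    (M := (commutatorIdeal treeAlgebra).toSubmodule.comap modelCLM.toLinearMap)
    ((isClosed_commutatorIdeal treeAlgebra).preimage modelCLM.continuous)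
    modelUnit_mem_commutatorIdeal hF

/-- The sum of the model operators and the compact operators. -/
def modelExtension : NonUnitalStarSubalgebra ℂ (ℓ²(Vertex, ℂ) →L[ℂ] ℓ²(Vertex, ℂ)) :=
  splitExtension compactTensor modelHom

theorem isClosed_modelExtension :
    IsClosed (modelExtension : Set (ℓ²(Vertex, ℂ) →L[ℂ] ℓ²(Vertex, ℂ))) :=
  isClosed_splitExtension isClosed_closure norm_modelHom_le
    fun F _ hk => norm_le_norm_modelHom_add F hk

theorem compacts_le_modelExtension : compacts ℓ²(Vertex, ℂ) ≤ modelExtension := fun k hk =>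
  ⟨0, zero_mem _, k, hk, by rw [map_zero, zero_add]⟩

theorem modelUnit_mem_modelExtension (m n : ℕ) (f : C(Boundary, ℂ)) :
    modelUnit m n f ∈ modelExtension :=
  ⟨_, elemTensor_mem (matrixUnit_mem_compacts m n) f, 0, zero_mem _, (add_zero _).symm⟩

/-- An operator that maps the matrix units of the model into the extension absorbs it. -/
theorem mul_mem_modelExtension {a : ℓ²(Vertex, ℂ) →L[ℂ] ℓ²(Vertex, ℂ)}
    (h : ∀ m n f, a * modelUnit m n f ∈ modelExtension)
    {T : ℓ²(Vertex, ℂ) →L[ℂ] ℓ²(Vertex, ℂ)} (hT : T ∈ modelExtension) :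
    a * T ∈ modelExtension := by
  obtain ⟨F, hF, k, hk, rfl⟩ := hT
  rw [mul_add]
  refine add_mem ?_ (compacts_le_modelExtension (mul_mem_compacts a hk))
  exact mem_of_mem_compactTensor (M := modelExtension.toSubmodule.comap
    (LinearMap.mulLeft ℂ a ∘ₗ modelCLM.toLinearMap))
    (isClosed_modelExtension.preimage ((continuous_const_mul a).comp modelCLM.continuous)) h hF

theorem shift_eq : shift = (2 * invSqrtTwo) • isoShift := by
  rw [isoShift, smul_smul, mul_assoc, invSqrtTwo_mul_self]
  norm_num

theorem mulOp_mul_mem_modelExtension (f : C(Compactification, ℂ))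
    {T : ℓ²(Vertex, ℂ) →L[ℂ] ℓ²(Vertex, ℂ)} (hT : T ∈ modelExtension) :
    mulOp f * T ∈ modelExtension :=
  mul_mem_modelExtension (fun m n g => by
    have := add_mem (compacts_le_modelExtension (mulOp_mul_modelUnit f m n g))
      (modelUnit_mem_modelExtension m n (f.comp boundaryInclusion * g))
    rwa [sub_add_cancel] at this) hT

theorem shift_mul_mem_modelExtension {T : ℓ²(Vertex, ℂ) →L[ℂ] ℓ²(Vertex, ℂ)}
    (hT : T ∈ modelExtension) : shift * T ∈ modelExtension :=
  mul_mem_modelExtension (fun m n g => by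
    rw [shift_eq, smul_mul_assoc, isoShift_mul_modelUnit]
    exact SMulMemClass.smul_mem _ (modelUnit_mem_modelExtension _ _ _)) hT

theorem star_shift_mul_mem_modelExtension {T : ℓ²(Vertex, ℂ) →L[ℂ] ℓ²(Vertex, ℂ)}
    (hT : T ∈ modelExtension) : star shift * T ∈ modelExtension :=
  mul_mem_modelExtension (fun m n g => by
    rw [shift_eq, star_smul, smul_mul_assoc]
    refine SMulMemClass.smul_mem _ ?_
    cases m with
    | zero =>
      rw [star_isoShift_mul_modelUnit_zero]
      exact zero_mem _
    | succ m =>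
      rw [star_isoShift_mul_modelUnit_succ]
      exact modelUnit_mem_modelExtension _ _ _) hT

/-- The commutator ideal consists of the sums of model operators and compact operators. -/
theorem commutatorIdeal_treeAlgebra : commutatorIdeal treeAlgebra = modelExtension := by
  refine le_antisymm ?_ ?_
  · refine commutatorIdeal_le_of_generators isClosed_modelExtension ?_ ?_
    · rintro _ (rfl | ⟨f, rfl⟩) T hT
      · exact ⟨shift_mul_mem_modelExtension hT, star_shift_mul_mem_modelExtension hT⟩
      · rw [star_mulOp]
        exact ⟨mulOp_mul_mem_modelExtension f hT, mulOp_mul_mem_modelExtension _ hT⟩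
    · have hc := fun f => compacts_le_modelExtension (shift_mulOp_commutator_mem f)
      rintro _ (rfl | ⟨f, rfl⟩) _ (rfl | ⟨g, rfl⟩)
      · refine ⟨by rw [sub_self]; exact zero_mem _, ?_⟩
        have h := SMulMemClass.smul_mem (-(2 * invSqrtTwo * star (2 * invSqrtTwo)))
          (modelUnit_mem_modelExtension 0 0 1)
        rw [shift_eq, star_smul, smul_mul_smul_comm, smul_mul_smul_comm, star_isoShift_mul_self,
          mul_comm (star _), ← smul_sub, ← neg_sub, one_sub_isoShift_mul_star, smul_neg, ← neg_smul]
        exact h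
      · rw [star_mulOp]
        exact ⟨hc g, hc _⟩
      · refine ⟨by simpa using neg_mem (hc f), ?_⟩
        have := star_mem (hc (star f))
        simpa [star_mulOp] using this
      · rw [star_mulOp, mulOp_mul_comm f g, mulOp_mul_comm f (star g), sub_self, sub_self]
        exact ⟨zero_mem _, zero_mem _⟩
  · rintro _ ⟨F, hF, k, hk, rfl⟩
    exact add_mem (modelHom_mem_commutatorIdeal hF) (compacts_le_commutatorIdeal hk)

end CommutatorIdealTree

end BinaryTree
end

theorem theorem4p1 :
    ∃ (h : BinaryTree.compacts ℓ²(BinaryTree.Vertex, ℂ) ≤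
        BinaryTree.commutatorIdeal BinaryTree.treeAlgebra)
      (π : BinaryTree.commutatorIdeal BinaryTree.treeAlgebra →⋆ₙₐ[ℂ]
        BinaryTree.tensorContinuous (BinaryTree.compacts ℓ²(ℕ, ℂ)) BinaryTree.Boundary),
      Function.Injective (NonUnitalStarSubalgebra.inclusion h) ∧
      Function.Exact (NonUnitalStarSubalgebra.inclusion h) π ∧
      Function.Surjective π := by
  exact BinaryTree.exact_of_commutatorIdeal_eq BinaryTree.commutatorIdeal_treeAlgebra
    fun _ hF => BinaryTree.eq_zero_of_modelHom_mem_compacts hF
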